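/- A generalized semi-Markov process (GSMP) consists of a finite set of states, a finite set of events, a nonempty set $\mathbf E(s)$ of events scheduled in each state $s$, a distribution $\mathrm{Succ}(s,A)$ of the successor state for each state $s$ and each set $A$ of simultaneously occurring events, and an initial distribution. Each event $e$ has bounds $\ell_e\in\mathbb N_0$, $u_e\in\{1,2,\dots\}\cup\{\infty\}$, $\ell_e\le u_e$; it is a fixed-delay event if $\ell_e=u_e$, and otherwise a variable-delay event whose delay has a density that is positive and continuous on $[\ell_e,u_e]$ (on $[\ell_e,\infty)$ if $u_e=\infty$), zero elsewhere, and of finite mean. A configuration is a state together with the time elapsed since the scheduling of each event scheduled in it (and the time spent in the previous configuration). The process starts with zero elapsed times; in each step the scheduled events compete, the first set $A$ of events occurs, the state changes according to $\mathrm{Succ}(s,A)$, scheduled events that did not occur and are still scheduled keep running, and the newly scheduled ones (including those in $A$ that are scheduled again) start from $0$. This defines a Markov chain on configurations with transition kernel $P$, and a probability measure $\mathcal P$ on runs (infinite sequences of configurations). Two configurations lie in the same region if they have the same state $s$, the elapsed times of each event of $\mathbf E(s)$ either agree on integral parts and on being an integer or both exceed the largest finite bound $B$ of the process, and the fractional parts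 of those elapsed times that are at most $B$ are ordered in the same way. The region graph has the (finitely many) regions as vertices and an edge $(R,R')$ whenever $P(z,R')>0$ for some $z\in R$. A bottom strongly connected component (BSCC) is a nonempty set $C$ of regions such that from each region of $C$ exactly the regions of $C$ are reachable. **Claim.** Consider the GSMP with fixed-delay events $p,c$ of delay $1$, variable-delay events $t,t'$ uniformly distributed on $[0,1]$, and the following states, with scheduled events and transitions: - $\mathit{Init}$ with $\{p\}$, the initial state: $p$ leads to $\mathit{C\text{-}waiting}$; - $\mathit{C\text{-}waiting}$ with $\{p,t\}$: $t$ leads to $\mathit{Delivered}$; - $\mathit{Delivered}$ with $\{p,c,t'\}$: $p$ leads to $\mathit{Transporting}$, $t'$ leads to $\mathit{Sink}$; - $\mathit{Transporting}$ with $\{p,c,t\}$: $t$ leads to $\mathit{Consuming}$, $c$ leads to $\mathit{C\text{-}waiting}$; - $\mathit{Consuming}$ with $\{p,c\}$: $c$ leads to $\mathit{Consuming}$ (with $c$ scheduled anew), $p$ leads to $\mathit{Transporting}$; - $\mathit{Sink}$ with $\{p\}$: $p$ leads to $\mathit{Sink}$ (all other sets of events leave the state unchanged). Then: 1. $p$ and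 $c$ are exactly its fixed-delay events. 2. The region graph predicts that $\mathit{Sink}$ is reached with probability $1$: some BSCC is reachable from the region of the initial configuration, and every BSCC reachable from it consists of regions with state $\mathit{Sink}$. Hence an algorithm that assumes that almost every run enters a BSCC of the region graph and then visits all of its regions, and therefore checks that every reachable BSCC contains a region with state $\mathit{Sink}$, returns probability $1$. 3. The probability measure $\mathcal P$ on runs exists and is unique, and $\mathcal P(\mathit{Sink}\text{ is reached})<1$. 4. The probability that a run visits a region belonging to a BSCC of the region graph is strictly less than $1$. 5. The product $\prod_{i=1}^{\infty}(1-2^{-i})^{2i}$ converges to a positive real number, and $$\mathcal P(\mathit{Sink}\text{ is never reached})\ \ge\ \prod_{i=1}^{\infty}(1-2^{-i})^{2i}\ >\ 0 .$$ -/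

import Mathlib

open MeasureTheory Set
open scoped NNReal ENNReal

/-- The range `[l, u]` (or `[l, ∞)` if `u = ∞`) of the delay of an event. -/
def delayRange (l : ℕ) (u : ℕ∞) : Set ℝ :=
  {x | (l : ℝ) ≤ x ∧ ∀ n : ℕ, u = n → x ≤ n}

/-- Generalized semi-Markov processes with finite sets `S` of states and `E` of events.
An event with `lower e = upper e` has a fixed delay; all others have a variable delay which is
distributed with density `density e`. (For fixed-delay events, `density e` is not used.) -/
structure GSMP (S E : Type*) [Fintype S] [Fintype E] where
  /-- lower bound of the delay -/
  lower : E → ℕ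
  /-- upper bound of the delay, a positive integer or infinity -/
  upper : E → ℕ∞
  one_le_upper : ∀ e, 1 ≤ upper e
  lower_le_upper : ∀ e, (lower e : ℕ∞) ≤ upper e
  /-- density of the delay of a variable-delay event -/
  density : E → ℝ → ℝ
  density_pos : ∀ e, (lower e : ℕ∞) < upper e →
    ∀ x ∈ delayRange (lower e) (upper e), 0 < density e x
  density_continuousOn : ∀ e, (lower e : ℕ∞) < upper e →
    ContinuousOn (density e) (delayRange (lower e) (upper e))
  density_eq_zero : ∀ e, (lower e : ℕ∞) < upper e →
    ∀ x, x ∉ delayRange (lower e) (upper e) → density e x = 0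
  density_integral : ∀ e, (lower e : ℕ∞) < upper e →
    ∫ x in delayRange (lower e) (upper e), density e x = 1
  density_mean : ∀ e, (lower e : ℕ∞) < upper e →
    IntegrableOn (fun x => x * density e x) (delayRange (lower e) (upper e))
  /-- the set of events scheduled in a state -/
  sched : S → Finset E
  sched_nonempty : ∀ s, (sched s).Nonempty
  /-- distribution of the successor when a set of events occurs in a state -/
  succ : S → Finset E → PMF S
  /-- initial distribution -/
  start : PMF S

namespace GSMP

variable {S E : Type*} [Fintype S] [Fintype E] [DecidableEq E] (G : GSMP S E)

/-- A fixed-delay event; the other events are the variable-delay events. -/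
def IsFixed (e : E) : Prop := (G.lower e : ℕ∞) = G.upper e

/-- Configurations `(s, ν, δ)`: a state `s`, the elapsed time `ν e` of every event `e` scheduled
in `s`, and the time `δ` spent in the previous configuration. The value "undefined" of `ν` at the
events that are not scheduled in `s` is encoded as `0`. -/
abbrev Config : Type _ :=
  {z : S × (E → ℝ≥0) × ℝ≥0 // ∀ e, e ∉ G.sched z.1 → z.2.1 e = 0}

namespace Config

variable {G}

/-- The state of a configuration. -/
def state (z : G.Config) : S := z.1.1

/-- The time that elapsed since the event was scheduled. -/
def val (z : G.Config) (e : E) : ℝ≥0 := z.1.2.1 e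

end Config

/-- The configuration with state `s` and zero valuation. -/
def zeroConfig (s : S) : G.Config := ⟨(s, 0, 0), fun _ _ => rfl⟩

/-- The configuration entered when, after time `t` in `z`, the set `A` of events occurs and the
process moves to `s'`: inherited events keep running, new events start from `0`. -/
def next (z : G.Config) (A : Finset E) (s' : S) (t : ℝ≥0) : G.Config :=
  ⟨(s', fun e => if e ∈ G.sched s' ∧ e ∈ G.sched z.state ∧ e ∉ A then z.val e + t else 0, t),
    fun _ he => if_neg fun h => he h.1⟩

open Classical in
/-- The variable-delay events scheduled in `z`. -/
noncomputable def variableEvents (z : G.Config) : Finset E :=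
  (G.sched z.state).filter fun e => ¬ G.IsFixed e

open Classical in
/-- The fixed-delay events scheduled in `z`. -/
noncomputable def fixedEvents (z : G.Config) : Finset E :=
  (G.sched z.state).filter fun e => G.IsFixed e

/-- The minimal remaining time of a scheduled fixed-delay event; it is `∞` if there is none. -/
noncomputable def timeLimit (z : G.Config) : ℝ≥0∞ :=
  ⨅ e ∈ G.fixedEvents z, (((G.lower e : ℝ≥0) - z.val e : ℝ≥0) : ℝ≥0∞)

open Classical in
/-- The scheduled fixed-delay events whose remaining time is minimal. -/
noncomputable def firstFixed (z : G.Config) : Finset E :=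
  (G.fixedEvents z).filter fun e =>
    (((G.lower e : ℝ≥0) - z.val e : ℝ≥0) : ℝ≥0∞) = G.timeLimit z

open Classical in
/-- Density of the remaining delay of a variable-delay event `e` after time `a` has elapsed. -/
noncomputable def shiftedDensity (e : E) (a : ℝ≥0) (x : ℝ) : ℝ :=
  if 0 ≤ x ∧ (a : ℝ≥0∞) < (G.upper e : ℝ≥0∞) then
    G.density e (x + a) / ∫ y in Ioi (a : ℝ), G.density e y
  else 0

/-- Probability that none of the variable-delay events in `A`, with elapsed times as in `z`,
occurs within time `t`. -/
noncomputable def survival (z : G.Config) (A : Finset E) (t : ℝ) : ℝ :=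
  ∏ c ∈ A, ∫ y in Ioi t, G.shiftedDensity c (z.val c) y

/-- Density of the time at which the variable-delay event `e` wins the competition in `z`. -/
noncomputable def winDensity (z : G.Config) (e : E) (t : ℝ) : ℝ :=
  G.shiftedDensity e (z.val e) t * G.survival z ((G.variableEvents z).erase e) t

section Chain

variable [MeasurableSpace S]

lemma measurable_next (z : G.Config) (A : Finset E) (s' : S) :
    Measurable fun t : ℝ => G.next z A s' t.toNNReal := by
  refine Measurable.subtype_mk ?_
  refine measurable_const.prodMk (Measurable.prodMk ?_ measurable_real_toNNReal)
  refine measurable_pi_lambda _ fun e => ?_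
  split_ifs
  · exact measurable_const.add measurable_real_toNNReal
  · exact measurable_const

open Classical in
/-- The one-step transition kernel `P(z, ·)`: either a variable-delay event `e` wins at a time
before the first fixed-delay event, or the fixed-delay events with minimal remaining time occur. -/
noncomputable def transition (z : G.Config) : Measure G.Config :=
  (∑ e ∈ G.variableEvents z, ∑ s' : S, G.succ z.state {e} s' •
    ((volume.restrict {t : ℝ | 0 < t ∧ ENNReal.ofReal t < G.timeLimit z}).withDensity
      fun t => ENNReal.ofReal (G.winDensity z e t)).map
        fun t => G.next z {e} s' t.toNNReal) +
  (if G.fixedEvents z = ∅ then 0 else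
    ENNReal.ofReal (G.survival z (G.variableEvents z) (G.timeLimit z).toReal) •
      ∑ s' : S, G.succ z.state (G.firstFixed z) s' •
        Measure.dirac (G.next z (G.firstFixed z) s' (G.timeLimit z).toNNReal))

/-- The initial measure: zero valuation, state distributed as `start`. -/
noncomputable def initialMeasure : Measure G.Config :=
  ∑ s : S, G.start s • Measure.dirac (G.zeroConfig s)

/-- `∫_{z₁ ∈ A 0} ⋯ ∫_{zₙ ∈ A (n-1)} P(z, dz₁) ⋯ P(zₙ₋₁, dzₙ)`. -/
noncomputable def pathWeight : ℕ → (ℕ → Set G.Config) → G.Config → ℝ≥0∞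
  | 0, _, _ => 1
  | n + 1, A, z => ∫⁻ z' in A 0, pathWeight n (fun i => A (i + 1)) z' ∂(G.transition z)

/-- `Q` is the probability measure on runs (infinite sequences of configurations, with the product
σ-field) of the Markov chain with the initial measure and transition kernel of `G`. -/
structure IsRunMeasure (Q : Measure (ℕ → G.Config)) : Prop where
  isProbabilityMeasure : IsProbabilityMeasure Q
  cylinder : ∀ (n : ℕ) (A : ℕ → Set G.Config), (∀ i, MeasurableSet (A i)) →
    Q {σ | ∀ i ≤ n, σ i ∈ A i} =
      ∫⁻ z in A 0, G.pathWeight n (fun i => A (i + 1)) z ∂G.initialMeasure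

end Chain

/-- The maximum of all finite bounds on delays. -/
def maxBound : ℕ := Finset.univ.sup fun e => max (G.lower e) (G.upper e).toNat

end GSMP

/-- The integral parts agree, and neither or both numbers are integers. -/
def AgreeIntegral (a b : ℝ) : Prop := ⌊a⌋ = ⌊b⌋ ∧ (Int.fract a = 0 ↔ Int.fract b = 0)

lemma AgreeIntegral.le_nat {a b : ℝ} (h : AgreeIntegral a b) {B : ℕ} (ha : a ≤ B) : b ≤ B := by
  obtain ⟨h1, h2⟩ := h
  rcases ha.lt_or_eq with hlt | rfl
  · have : ⌊a⌋ < (B : ℤ) := Int.floor_lt.2 (by simpa using hlt)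
    rw [h1] at this
    simpa using (Int.floor_lt.1 this).le
  · have hb : Int.fract b = 0 := h2.1 (by simp)
    have := Int.floor_add_fract b
    rw [hb, ← h1] at this
    simp at this
    exact this.ge

namespace GSMP

variable {S E : Type*} [Fintype S] [Fintype E] [DecidableEq E] (G : GSMP S E)

/-- The region relation. -/
structure RegionRel (z w : G.Config) : Prop where
  state_eq : z.state = w.state
  agree : ∀ e ∈ G.sched z.state, AgreeIntegral (z.val e) (w.val e) ∨
    ((G.maxBound : ℝ) < z.val e ∧ (G.maxBound : ℝ) < w.val e)
  order : ∀ e ∈ G.sched z.state, ∀ f ∈ G.sched z.state,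
    (z.val e : ℝ) ≤ G.maxBound → (z.val f : ℝ) ≤ G.maxBound →
      (Int.fract (z.val e : ℝ) ≤ Int.fract (z.val f : ℝ) ↔
        Int.fract (w.val e : ℝ) ≤ Int.fract (w.val f : ℝ))

variable {G} in
lemma RegionRel.val_le {z w : G.Config} (h : G.RegionRel z w) {e : E}
    (he : e ∈ G.sched z.state) : (z.val e : ℝ) ≤ G.maxBound ↔ (w.val e : ℝ) ≤ G.maxBound := by
  rcases h.agree e he with h | h
  · exact ⟨fun hz => h.le_nat hz,
      fun hw => AgreeIntegral.le_nat (a := w.val e) ⟨h.1.symm, h.2.symm⟩ hw⟩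
  · exact ⟨fun hz => absurd h.1 hz.not_gt, fun hw => absurd h.2 hw.not_gt⟩

/-- The region relation as an equivalence relation. -/
def regionSetoid : Setoid G.Config where
  r := G.RegionRel
  iseqv :=
    { refl := fun _ => ⟨rfl, fun _ _ => Or.inl ⟨rfl, Iff.rfl⟩, fun _ _ _ _ _ _ => Iff.rfl⟩
      symm := fun {z w} h => by
        refine ⟨h.state_eq.symm, fun e he => ?_, fun e he f hf h1 h2 => ?_⟩
        · rw [← h.state_eq] at he
          exact (h.agree e he).imp (fun h => ⟨h.1.symm, h.2.symm⟩) And.symm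
        · rw [← h.state_eq] at he hf
          exact (h.order e he f hf ((h.val_le he).2 h1) ((h.val_le hf).2 h2)).symm
      trans := fun {x y z} h k => by
        refine ⟨h.state_eq.trans k.state_eq, fun e he => ?_, fun e he f hf h1 h2 => ?_⟩
        · have he' : e ∈ G.sched y.state := h.state_eq ▸ he
          by_cases hx : (x.val e : ℝ) ≤ G.maxBound
          · have hy := (h.val_le he).1 hx
            have a1 := (h.agree e he).resolve_right fun h => absurd h.1 hx.not_gt
            have a2 := (k.agree e he').resolve_right fun h => absurd h.1 hy.not_gt
            exact Or.inl ⟨a1.1.trans a2.1, a1.2.trans a2.2⟩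
          · refine Or.inr ⟨not_le.1 hx, not_le.1 fun hz => hx ?_⟩
            exact (h.val_le he).2 ((k.val_le he').2 hz)
        · have he' : e ∈ G.sched y.state := h.state_eq ▸ he
          have hf' : f ∈ G.sched y.state := h.state_eq ▸ hf
          exact (h.order e he f hf h1 h2).trans
            (k.order e he' f hf' ((h.val_le he).1 h1) ((h.val_le hf).1 h2)) }

/-- Regions, the vertices of the region graph. -/
abbrev Region : Type _ := Quotient G.regionSetoid

/-- The region of a configuration. -/
def region (z : G.Config) : G.Region := Quotient.mk G.regionSetoid z

/-- The state of a region. -/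
def Region.state {G : GSMP S E} (R : G.Region) : S :=
  Quotient.lift (s := G.regionSetoid) Config.state (fun _ _ h => h.state_eq) R

variable [MeasurableSpace S]

/-- Edges of the region graph. -/
def RegionEdge (R R' : G.Region) : Prop :=
  ∃ z : G.Config, G.region z = R ∧ 0 < G.transition z {w | G.region w = R'}

/-- Bottom strongly connected components of the region graph: nonempty sets `C` of regions such
that from every region in `C` precisely the regions in `C` are reachable. -/
def IsBSCC (C : Set G.Region) : Prop :=
  C.Nonempty ∧ ∀ R ∈ C, ∀ R', Relation.ReflTransGen G.RegionEdge R R' ↔ R' ∈ C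

/-- `R` is reachable in the region graph from the region of a possible initial configuration. -/
def RegionReachable (R : G.Region) : Prop :=
  ∃ s : S, G.start s ≠ 0 ∧ Relation.ReflTransGen G.RegionEdge (G.region (G.zeroConfig s)) R

/-- The criterion by which an algorithm working on the region graph answers that the (absorbing)
state `s` is reached with probability one: taking for granted that almost every run enters a
bottom strongly connected component and then visits all of its regions, it checks that each
bottom strongly connected component reachable from the initial region contains a region with
state `s`. -/
def RegionAlgorithmReturnsOne (s : S) : Prop :=
  ∀ C : Set G.Region, G.IsBSCC C → (∃ R ∈ C, G.RegionReachable R) → ∃ R ∈ C, R.state = s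

end GSMP

/-! ### The producer-consumer example -/

/-- States of the example. -/
inductive PCState where
  | Init | CWaiting | Delivered | Transporting | Consuming | Sink
  deriving DecidableEq

/-- Events of the example: production `p`, consumption `c`, transport `t`, failure `t'`. -/
inductive PCEvent where
  | p | c | t | t'
  deriving DecidableEq

instance : Fintype PCState where
  elems := {.Init, .CWaiting, .Delivered, .Transporting, .Consuming, .Sink}
  complete := fun s => by cases s <;> decide

instance : Fintype PCEvent where
  elems := {.p, .c, .t, .t'}
  complete := fun e => by cases e <;> decide

instance : MeasurableSpace PCState := ⊤

instance : DiscreteMeasurableSpace PCState := ⟨fun _ => trivial⟩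

namespace PC

open PCState PCEvent

/-- Production and consumption take exactly one time unit; the other delays vary in `[0, 1]`. -/
def lower : PCEvent → ℕ
  | p => 1
  | c => 1
  | t => 0
  | t' => 0

/-- Scheduled events. -/
def sched : PCState → Finset PCEvent
  | Init => {p}
  | CWaiting => {p, t}
  | Delivered => {p, c, t'}
  | Transporting => {p, c, t}
  | Consuming => {p, c}
  | Sink => {p}

/-- The transitions of the example. Sets of events that are not listed (they occur with
probability zero) do not change the state. -/
def move (s : PCState) (A : Finset PCEvent) : PCState :=
  if s = Init ∧ A = {p} then CWaiting
  else if s = CWaiting ∧ A = {t} then Delivered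
  else if s = Delivered ∧ A = {p} then Transporting
  else if s = Delivered ∧ A = {t'} then Sink
  else if s = Transporting ∧ A = {c} then CWaiting
  else if s = Transporting ∧ A = {t} then Consuming
  else if s = Consuming ∧ A = {p} then Transporting
  else s

lemma delayRange_zero_one : delayRange 0 1 = Icc (0 : ℝ) 1 := by
  ext x
  simp only [delayRange, mem_ofPred_eq, mem_Icc, Nat.cast_zero]
  refine and_congr_right fun _ => ⟨fun h => by simpa using h 1 (by simp), fun h n hn => ?_⟩
  have : n = 1 := by exact_mod_cast hn.symm
  simpa [this] using h

lemma lower_of_lt {e : PCEvent} (h : (lower e : ℕ∞) < 1) : lower e = 0 := by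
  exact_mod_cast Order.lt_one_iff.1 h

end PC

/-- The example: a producer-consumer system with two fixed-delay events `p`, `c` of delay `1` and
two variable-delay events `t`, `t'` that are uniformly distributed on `[0, 1]`. -/
noncomputable def producerConsumer : GSMP PCState PCEvent where
  lower := PC.lower
  upper := fun _ => 1
  one_le_upper := fun _ => le_rfl
  lower_le_upper := fun e => by cases e <;> simp [PC.lower]
  density := fun _ => (Icc (0 : ℝ) 1).indicator fun _ => 1
  density_pos := fun e he x hx => by
    rw [PC.lower_of_lt he, PC.delayRange_zero_one] at hx
    simp [hx]
  density_continuousOn := fun e he => by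
    rw [PC.lower_of_lt he, PC.delayRange_zero_one]
    exact continuousOn_const.congr fun x hx => indicator_of_mem hx _
  density_eq_zero := fun e he x hx => by
    rw [PC.lower_of_lt he, PC.delayRange_zero_one] at hx
    exact indicator_of_notMem hx _
  density_integral := fun e he => by
    rw [PC.lower_of_lt he, PC.delayRange_zero_one, setIntegral_indicator measurableSet_Icc]
    simp
  density_mean := fun e he => by
    rw [PC.lower_of_lt he, PC.delayRange_zero_one]
    have h : IntegrableOn (fun x : ℝ => x) (Icc 0 1) := continuous_id.integrableOn_Icc
    refine h.congr_fun (fun x hx => ?_) measurableSet_Icc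
    simp [indicator_of_mem hx]
  sched := PC.sched
  sched_nonempty := fun s => by cases s <;> simp [PC.sched]
  succ := fun s A => PMF.pure (PC.move s A)
  start := PMF.pure PCState.Init

/-! Let `d` be the age of `p` at the moment when `c` is started, that is, on entry to `Delivered`.
Survival there requires `t'` to last longer than `1 - d`, which has probability `d`. Both clocks
have period 1, so their phase difference persists through `Transporting` and `Consuming`, and on
return to `CWaiting` the age of `p` and `t` is again `d`. Now `t` fires before `p` almost surely, so
the next phase is `d + (1 - d) * u` with `u` uniform on `(0, 1)`. The danger `1 - d` is thus
multiplied by a fresh uniform factor in every cycle, and the product of the survival probabilities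
stays positive. Regions only record `0 < d < 1`, so in the region graph `Sink` is always within
reach.

This is made quantitative by a harmonic function. Survival from `CWaiting` with age `a` should be an
`h` satisfying `h a = (1 - a)⁻¹ * ∫ y in a..1, y * h y`, and `h a = exp (a - 1)` is a solution.
Transported to the other states it becomes `avoidProb`, which vanishes on `Sink`, is at most 1, and
does not exceed its mean after one step (`avoidProb_le_lintegral`). Iteration bounds the probability
of avoiding `Sink` from below by `exp (-1)` (`exp_neg_one_le_measure`). The infinite product is at
most its first factor `1/4`, hence smaller than `exp (-1)`; no cycle-by-cycle comparison is needed.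

All computations take place on the almost surely invariant set `Good`, where the kernel is the law
of an explicit map `step` of one uniform variable (`transition_eq`, `good_step`). Iterating `step`
along independent noise constructs the run measure.

`Good` is a union of regions (`good_of_regionRel`), and every good region leads to the absorbing
`sinkRegion` (`leadsToSink`). Hence `{sinkRegion}` is the only BSCC meeting `Good` (`isBSCC_eq`),
and a good run that avoids `Sink` never visits a BSCC. -/

namespace PC

open PCState PCEvent GSMP

/-- Configurations of the example. -/
abbrev Cfg : Type := producerConsumer.Config

/-! ### The transition kernel as the law of a function of uniform noise -/

lemma isFixed_iff (e : PCEvent) : producerConsumer.IsFixed e ↔ e = p ∨ e = c := by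
  change ((lower e : ℕ) : ℕ∞) = 1 ↔ _
  cases e <;> simp [lower]

lemma mem_fixedEvents {z : Cfg} {e : PCEvent} :
    e ∈ producerConsumer.fixedEvents z ↔ e ∈ sched z.state ∧ (e = p ∨ e = c) := by
  simp only [fixedEvents, Finset.mem_filter, isFixed_iff]
  rfl

lemma mem_variableEvents {z : Cfg} {e : PCEvent} :
    e ∈ producerConsumer.variableEvents z ↔ e ∈ sched z.state ∧ (e = t ∨ e = t') := by
  simp only [variableEvents, Finset.mem_filter, isFixed_iff]
  change e ∈ sched z.state ∧ _ ↔ _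
  cases e <;> simp

/-- The fixed-delay event with the largest elapsed time occurs first. -/
lemma first_fixed {z : Cfg} {e : PCEvent} (he : e ∈ producerConsumer.fixedEvents z)
    (h : ∀ f ∈ producerConsumer.fixedEvents z, f ≠ e → z.val f < z.val e ∧ z.val f < 1) :
    producerConsumer.timeLimit z = ((1 - z.val e : ℝ≥0) : ℝ≥0∞) ∧
      producerConsumer.firstFixed z = {e} := by
  have hl : ∀ f ∈ producerConsumer.fixedEvents z, (producerConsumer.lower f : ℝ≥0) = 1 := by
    intro f hf
    change ((lower f : ℕ) : ℝ≥0) = 1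
    rcases (mem_fixedEvents.1 hf).2 with rfl | rfl <;> simp [lower]
  have hlt : ∀ f ∈ producerConsumer.fixedEvents z, f ≠ e → 1 - z.val e < 1 - z.val f := by
    intro f hf hfe
    obtain ⟨h1, h2⟩ := h f hf hfe
    -- Subtraction in `ℝ≥0` is truncated: an overdue `e` has remaining time 0, and it beats `f` only
    -- because `f` is known to be younger than 1.
    rcases le_total 1 (z.val e) with h3 | h3
    · rw [tsub_eq_zero_of_le h3]
      exact tsub_pos_of_lt h2
    · exact tsub_lt_tsub_left_of_le h3 h1
  have hlim : producerConsumer.timeLimit z = ((1 - z.val e : ℝ≥0) : ℝ≥0∞) := by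
    refine le_antisymm ?_ (le_iInf₂ fun f hf => ?_)
    · refine (iInf₂_le e he).trans ?_
      rw [hl e he]
    · rw [hl f hf]
      by_cases hfe : f = e
      · rw [hfe]
      · exact_mod_cast (hlt f hf hfe).le
  refine ⟨hlim, ?_⟩
  ext f
  simp only [firstFixed, Finset.mem_filter, hlim, Finset.mem_singleton]
  constructor
  · rintro ⟨hf, h1⟩
    by_contra hfe
    rw [hl f hf] at h1
    exact (hlt f hf hfe).ne' (by exact_mod_cast h1)
  · rintro rfl
    exact ⟨he, by rw [hl f he]⟩

/-- The noise that drives the process. -/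
noncomputable abbrev noise : Measure ℝ := volume.restrict (Ioo 0 1)

instance : IsProbabilityMeasure noise := ⟨by simp⟩

/-- The configuration entered after time `x` when the set `A` of events occurs. -/
noncomputable def fire (z : Cfg) (A : Finset PCEvent) (x : ℝ≥0) : Cfg :=
  producerConsumer.next z A (move z.state A) x

/-- The variable-delay event `v` competes against the fixed-delay event `f`. -/
noncomputable def compete (z : Cfg) (v f : PCEvent) (u : ℝ) : Cfg :=
  if (1 - z.val v) * u.toNNReal < 1 - z.val f then fire z {v} ((1 - z.val v) * u.toNNReal)
  else fire z {f} (1 - z.val f)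

lemma sum_succ_smul {α : Type*} [MeasurableSpace α] (s : PCState) (A : Finset PCEvent)
    (μ : PCState → Measure α) :
    ∑ s' : PCState, producerConsumer.succ s A s' • μ s' = μ (move s A) := by
  change ∑ s' : PCState, PMF.pure (move s A) s' • μ s' = _
  rw [Finset.sum_eq_single (move s A)]
  · simp
  · intro b _ hb
    simp [hb]
  · simp

lemma transition_of_no_variable {z : Cfg} {f : PCEvent}
    (hv : producerConsumer.variableEvents z = ∅) (hf : f ∈ producerConsumer.fixedEvents z)
    (h : ∀ g ∈ producerConsumer.fixedEvents z, g ≠ f → z.val g < z.val f ∧ z.val g < 1) :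
    producerConsumer.transition z = Measure.dirac (fire z {f} (1 - z.val f)) := by
  obtain ⟨hL, hA⟩ := first_fixed hf h
  have hne : producerConsumer.fixedEvents z ≠ ∅ := Finset.ne_empty_of_mem hf
  simp only [transition, hv, Finset.sum_empty, zero_add, if_neg hne, hL, hA, survival,
    Finset.prod_empty, ENNReal.ofReal_one, one_smul, sum_succ_smul, ENNReal.toNNReal_coe]
  rfl

/-- A uniform variable on `[0, 1]` conditioned to exceed `a` is uniform on `[a, 1]`. The density of
every event is the uniform one, so `e` is arbitrary here. -/
lemma shiftedDensity_eq {a : ℝ≥0} (ha : a < 1) (e : PCEvent) :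
    producerConsumer.shiftedDensity e a =
      (Icc (0 : ℝ) (1 - a)).indicator fun _ => (1 - (a : ℝ))⁻¹ := by
  have h1 : ∫ y in Ioi (a : ℝ), producerConsumer.density e y = 1 - a := by
    change ∫ y in Ioi (a : ℝ), (Icc (0 : ℝ) 1).indicator (fun _ => (1 : ℝ)) y = _
    rw [setIntegral_indicator measurableSet_Icc]
    have : Ioi (a : ℝ) ∩ Icc 0 1 = Ioc (a : ℝ) 1 := by
      ext x
      simp only [mem_inter_iff, mem_Ioi, mem_Icc, mem_Ioc]
      exact ⟨fun h => ⟨h.1, h.2.2⟩, fun h => ⟨h.1, (a.coe_nonneg.trans_lt h.1).le, h.2⟩⟩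
    have ha' : (a : ℝ) ≤ 1 := by exact_mod_cast ha.le
    simp [this, ha']
  funext x
  have hu : ((a : ℝ≥0∞) < (producerConsumer.upper e : ℝ≥0∞)) ↔ True := by
    simp only [iff_true]
    change (a : ℝ≥0∞) < ((1 : ℕ∞) : ℝ≥0∞)
    simpa using ha
  simp only [shiftedDensity, h1, hu, and_true]
  change (if 0 ≤ x then (Icc (0 : ℝ) 1).indicator (fun _ => (1 : ℝ)) (x + a) / (1 - a) else 0) = _
  simp only [indicator_apply, mem_Icc]
  have ha0 : (0 : ℝ) ≤ a := a.coe_nonneg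
  by_cases hx : 0 ≤ x
  · by_cases hx' : x ≤ 1 - a
    · rw [if_pos hx, if_pos ⟨by linarith, by linarith⟩, if_pos ⟨hx, hx'⟩, one_div]
    · rw [if_pos hx, if_neg (fun h => hx' (by linarith [h.2])), if_neg (fun h => hx' h.2), zero_div]
  · rw [if_neg hx, if_neg fun h => hx h.1]

lemma integral_shiftedDensity {a : ℝ≥0} (ha : a < 1) (e : PCEvent) {L : ℝ} (h0 : 0 ≤ L)
    (hL : L ≤ 1 - a) :
    ∫ y in Ioi L, producerConsumer.shiftedDensity e a y = (1 - a - L) * (1 - (a : ℝ))⁻¹ := by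
  rw [shiftedDensity_eq ha, setIntegral_indicator measurableSet_Icc]
  have : Ioi L ∩ Icc 0 (1 - (a : ℝ)) = Ioc L (1 - a) := by
    ext x
    simp only [mem_inter_iff, mem_Ioi, mem_Icc, mem_Ioc]
    exact ⟨fun h => ⟨h.1, h.2.2⟩, fun h => ⟨h.1, (h0.trans_lt h.1).le, h.2⟩⟩
  simp [this, hL]

/-- Splitting a uniform variable at `L / b`. -/
lemma map_noise_ite {α : Type*} [MeasurableSpace α] {b L : ℝ} (hb : 0 < b) (h0 : 0 ≤ L)
    (hL : L ≤ b) {g : ℝ → α} (hg : Measurable g) (y : α) :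
    noise.map (fun u => if b * u < L then g (b * u) else y) =
      ((volume.restrict (Ioo 0 L)).withDensity fun _ => ENNReal.ofReal b⁻¹).map g +
        ENNReal.ofReal ((b - L) * b⁻¹) • Measure.dirac y := by
  have hm : Measurable (fun u => if b * u < L then g (b * u) else y) :=
    Measurable.ite (measurableSet_lt (by fun_prop) measurable_const) (by fun_prop) measurable_const
  classical
  ext s hs
  rw [Measure.map_apply hm hs, Measure.add_apply, Measure.map_apply hg hs, withDensity_const,
    Measure.smul_apply, Measure.smul_apply, Measure.restrict_apply (hg hs),
    Measure.restrict_apply (hm hs), Measure.dirac_apply' _ hs]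
  -- Noise below `L / b` is rescaled to a time in `(0, L)`; the rest, of mass `(b - L) / b`, is sent
  -- to `y`.
  have hsplit : (fun u => if b * u < L then g (b * u) else y) ⁻¹' s ∩ Ioo 0 1 =
      ((fun u => b * u) ⁻¹' (g ⁻¹' s ∩ Ioo 0 L)) ∪
        (if y ∈ s then Ioo 0 1 ∩ Ici (L / b) else ∅) := by
    ext u
    have e1 : u < L / b ↔ b * u < L := lt_div_iff₀' hb
    by_cases hu : b * u < L
    · have : b * u < b := hu.trans_le hL
      have h1 : u < 1 := by nlinarith
      by_cases hy : y ∈ s <;> simp [hu, h1, hy, e1, ← not_lt, mul_pos_iff_of_pos_left hb]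
    · by_cases hy : y ∈ s <;> simp [hu, hy, e1, ← not_lt]
  have hd : Disjoint ((fun u => b * u) ⁻¹' (g ⁻¹' s ∩ Ioo 0 L))
      (if y ∈ s then Ioo 0 1 ∩ Ici (L / b) else ∅) := by
    split_ifs
    · refine Set.disjoint_left.2 fun u hu hu' => ?_
      have := (div_le_iff₀' hb).1 hu'.2
      exact absurd hu.2.2 this.not_gt
    · simp
  rw [hsplit, measure_union hd]
  · congr 1
    · rw [Real.volume_preimage_mul_left hb.ne', abs_of_pos (inv_pos.2 hb), smul_eq_mul]
    · by_cases hy : y ∈ s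
      · have hLb : 0 ≤ L / b := div_nonneg h0 hb.le
        have : volume (Ioo 0 1 ∩ Ici (L / b)) = ENNReal.ofReal (1 - L / b) := by
          refine le_antisymm ?_ ?_
          · refine (measure_mono (t := Icc (L / b) 1) fun u hu => ⟨hu.2, hu.1.2.le⟩).trans ?_
            simp
          · rw [← Real.volume_Ioo]
            exact measure_mono fun u hu => ⟨⟨hLb.trans_lt hu.1, hu.2⟩, hu.1.le⟩
        rw [if_pos hy, this]
        simp only [hy, indicator_of_mem, Pi.one_apply, smul_eq_mul, mul_one]
        congr 1
        field_simp
      · simp [hy]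
  · split_ifs
    · exact measurableSet_Ioo.inter measurableSet_Ici
    · exact MeasurableSet.empty

lemma measurable_fire (z : Cfg) (A : Finset PCEvent) :
    Measurable fun x : ℝ => fire z A x.toNNReal :=
  producerConsumer.measurable_next z A (move z.state A)

/-- The remaining delay of `v` is uniform on an interval of length `1 - z.val v`, so it is that
length times the noise. The condition `z.val v ≤ z.val f` puts the deadline of `f` inside this
interval, as `map_noise_ite` requires. -/
lemma transition_of_one_variable {z : Cfg} {v f : PCEvent}
    (hv : producerConsumer.variableEvents z = {v}) (hv1 : z.val v < 1)
    (hf : f ∈ producerConsumer.fixedEvents z) (hvf : z.val v ≤ z.val f)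
    (h : ∀ g ∈ producerConsumer.fixedEvents z, g ≠ f → z.val g < z.val f ∧ z.val g < 1) :
    producerConsumer.transition z = noise.map (compete z v f) := by
  obtain ⟨hL, hA⟩ := first_fixed hf h
  have hne : producerConsumer.fixedEvents z ≠ ∅ := Finset.ne_empty_of_mem hf
  have hb : (0 : ℝ) < 1 - z.val v := sub_pos.2 (by exact_mod_cast hv1)
  have hb' : (1 - (z.val v : ℝ)) = ((1 - z.val v : ℝ≥0) : ℝ) := by
    rw [NNReal.coe_sub hv1.le, NNReal.coe_one]
  have hle : ((1 - z.val f : ℝ≥0) : ℝ) ≤ 1 - z.val v := by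
    rw [hb']
    exact_mod_cast tsub_le_tsub_left hvf 1
  have key := map_noise_ite hb (NNReal.coe_nonneg (1 - z.val f)) hle (measurable_fire z {v})
    (fire z {f} (1 - z.val f))
  have hcomp : noise.map (compete z v f) = noise.map (fun u =>
      if (1 - (z.val v : ℝ)) * u < ((1 - z.val f : ℝ≥0) : ℝ) then
        fire z {v} ((1 - (z.val v : ℝ)) * u).toNNReal else fire z {f} (1 - z.val f)) := by
    -- Real and truncated arithmetic differ for negative `u`, but the noise is concentrated on `(0,
    -- 1)`.
    refine Measure.map_congr ((ae_restrict_iff' measurableSet_Ioo).2 (.of_forall fun u hu => ?_))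
    have h1 : ((1 - (z.val v : ℝ)) * u).toNNReal = (1 - z.val v) * u.toNNReal := by
      rw [Real.toNNReal_mul hb.le, hb', Real.toNNReal_coe]
    have h2 : (1 - (z.val v : ℝ)) * u < ((1 - z.val f : ℝ≥0) : ℝ) ↔
        (1 - z.val v) * u.toNNReal < 1 - z.val f := by
      rw [← NNReal.coe_lt_coe, NNReal.coe_mul, Real.coe_toNNReal _ hu.1.le, hb']
    simp only [compete, h1, h2]
  rw [hcomp, key]
  have hset : {x : ℝ | 0 < x ∧ ENNReal.ofReal x < ((1 - z.val f : ℝ≥0) : ℝ≥0∞)} =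
      Ioo 0 ((1 - z.val f : ℝ≥0) : ℝ) := by
    ext x
    simp only [mem_ofPred_eq, mem_Ioo]
    refine and_congr_right fun hx => ?_
    rw [ENNReal.ofReal, ENNReal.coe_lt_coe, Real.toNNReal_lt_iff_lt_coe hx.le]
  simp only [transition, hv, Finset.sum_singleton, if_neg hne, hL, hA, sum_succ_smul, hset,
    ENNReal.toNNReal_coe, ENNReal.coe_toReal, survival, Finset.prod_singleton]
  rw [integral_shiftedDensity hv1 v (NNReal.coe_nonneg _) hle]
  congr 2
  refine withDensity_congr_ae ((ae_restrict_iff' measurableSet_Ioo).2 (.of_forall fun x hx => ?_))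
  have hx1 : x ∈ Icc (0 : ℝ) (1 - z.val v) := ⟨hx.1.le, hx.2.le.trans hle⟩
  simp [winDensity, hv, survival, shiftedDensity_eq hv1, indicator_of_mem hx1]

end PC

/-! ### Constraints that hold almost surely, and the one-step map -/

namespace PC

open PCState PCEvent GSMP

@[simp] lemma state_fire (z : Cfg) (A : Finset PCEvent) (x : ℝ≥0) :
    (fire z A x).state = move z.state A := rfl

lemma val_fire (z : Cfg) (A : Finset PCEvent) (x : ℝ≥0) (e : PCEvent) :
    (fire z A x).val e =
      if e ∈ sched (move z.state A) ∧ e ∈ sched z.state ∧ e ∉ A then z.val e + x else 0 := rfl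

/-- The constraints on the elapsed times that hold along almost every run. -/
def GoodAt (s : PCState) (z : Cfg) : Prop :=
  match s with
  | Init => z.val p = 0
  | CWaiting => z.val p = z.val t ∧ z.val t < 1
  | Delivered => z.val c = 0 ∧ z.val t' = 0 ∧ 0 < z.val p ∧ z.val p < 1
  | Transporting => z.val p = 0 ∧ z.val t = 0 ∧ 0 < z.val c ∧ z.val c < 1
  | Consuming => (z.val p < z.val c ∧ z.val c < 1) ∨ (z.val c = 0 ∧ 0 < z.val p ∧ z.val p < 1)
  | Sink => True

/-- Configurations that occur along almost every run. -/
def Good (z : Cfg) : Prop := GoodAt z.state z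

/-- One step in the state `s`, as a function of the noise. -/
noncomputable def stepAt (s : PCState) (z : Cfg) (u : ℝ) : Cfg :=
  match s with
  | Init => fire z {p} (1 - z.val p)
  | CWaiting => compete z t p u
  | Delivered => compete z t' p u
  | Transporting => compete z t c u
  | Consuming => if z.val p < z.val c then fire z {c} (1 - z.val c) else fire z {p} (1 - z.val p)
  | Sink => fire z {p} (1 - z.val p)

/-- One step, as a function of the noise. -/
noncomputable def step (z : Cfg) (u : ℝ) : Cfg := stepAt z.state z u

lemma map_noise_const {α : Type*} [MeasurableSpace α] (y : α) :
    noise.map (fun _ => y) = Measure.dirac y := by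
  rw [Measure.map_const]
  simp

/-- The constraints in `Good` determine which fixed-delay event comes first and exclude ties, so
each state falls under one of the two preceding computations of the kernel. -/
theorem transition_eq {z : Cfg} (hz : Good z) :
    producerConsumer.transition z = noise.map (step z) := by
  have step_eq : step z = stepAt z.state z := rfl
  rw [Good] at hz
  rcases hs : z.state <;> rw [hs] at hz step_eq <;> rw [step_eq]
  · refine (transition_of_no_variable (f := p) ?_ ?_ ?_).trans (map_noise_const _).symm
    · ext e; simp only [mem_variableEvents, hs]; cases e <;> simp [sched]
    · simp [mem_fixedEvents, hs, sched]
    · intro g hg; simp only [mem_fixedEvents, hs] at hg; cases g <;> simp [sched] at hg ⊢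
  · refine transition_of_one_variable ?_ hz.2 ?_ hz.1.ge ?_
    · ext e; simp only [mem_variableEvents, hs]; cases e <;> simp [sched]
    · simp [mem_fixedEvents, hs, sched]
    · intro g hg; simp only [mem_fixedEvents, hs] at hg; cases g <;> simp [sched] at hg ⊢
  · obtain ⟨hc, ht, hp, hp1⟩ := hz
    refine transition_of_one_variable ?_ (by simp [ht]) ?_ (by simp [ht]) ?_
    · ext e; simp only [mem_variableEvents, hs]; cases e <;> simp [sched]
    · simp [mem_fixedEvents, hs, sched]
    · intro g hg; simp only [mem_fixedEvents, hs] at hg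
      cases g <;> simp [sched] at hg ⊢
      simp [hc, hp]
  · obtain ⟨hp, ht, hc, hc1⟩ := hz
    refine transition_of_one_variable ?_ (by simp [ht]) ?_ (by simp [ht]) ?_
    · ext e; simp only [mem_variableEvents, hs]; cases e <;> simp [sched]
    · simp [mem_fixedEvents, hs, sched]
    · intro g hg; simp only [mem_fixedEvents, hs] at hg
      cases g <;> simp [sched] at hg ⊢
      simp [hc, hp]
  · have hv : producerConsumer.variableEvents z = ∅ := by
      ext e; simp only [mem_variableEvents, hs]; cases e <;> simp [sched]
    rcases hz with ⟨h1, h2⟩ | ⟨hc, hp, hp1⟩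
    · rw [show stepAt Consuming z = fun _ => fire z {c} (1 - z.val c) from funext fun _ => if_pos h1]
      refine (transition_of_no_variable (f := c) hv ?_ ?_).trans (map_noise_const _).symm
      · simp [mem_fixedEvents, hs, sched]
      · intro g hg; simp only [mem_fixedEvents, hs] at hg
        cases g <;> simp [sched] at hg ⊢
        exact ⟨h1, h1.trans h2⟩
    · have h1 : ¬ z.val p < z.val c := by simp [hc]
      rw [show stepAt Consuming z = fun _ => fire z {p} (1 - z.val p) from funext fun _ => if_neg h1]
      refine (transition_of_no_variable (f := p) hv ?_ ?_).trans (map_noise_const _).symm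
      · simp [mem_fixedEvents, hs, sched]
      · intro g hg; simp only [mem_fixedEvents, hs] at hg
        cases g <;> simp [sched] at hg ⊢
        simp [hc, hp]
  · refine (transition_of_no_variable (f := p) ?_ ?_ ?_).trans (map_noise_const _).symm
    · ext e; simp only [mem_variableEvents, hs]; cases e <;> simp [sched]
    · simp [mem_fixedEvents, hs, sched]
    · intro g hg; simp only [mem_fixedEvents, hs] at hg; cases g <;> simp [sched] at hg ⊢

lemma noise_factor_lt {a : ℝ≥0} (ha : a < 1) {u : ℝ} (hu : u ∈ Ioo (0 : ℝ) 1) :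
    0 < (1 - a) * u.toNNReal ∧ (1 - a) * u.toNNReal < 1 - a := by
  have h1 : 0 < u.toNNReal := Real.toNNReal_pos.2 hu.1
  have h2 : u.toNNReal < 1 := by simpa using hu.2
  have h3 : 0 < 1 - a := tsub_pos_of_lt ha
  exact ⟨mul_pos h3 h1, mul_lt_of_lt_one_right h3 h2⟩

lemma add_lt_one {a b : ℝ≥0} (h : b < 1 - a) : a + b < 1 := by
  rw [add_comm]; exact lt_tsub_iff_right.1 h

theorem good_step {z : Cfg} (hz : Good z) {u : ℝ} (hu : u ∈ Ioo (0 : ℝ) 1) : Good (step z u) := by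
  have step_eq : step z u = stepAt z.state z u := rfl
  rw [Good] at hz
  rcases hs : z.state <;> rw [hs] at hz step_eq <;> rw [step_eq]
  · simp [Good, stepAt, hs, move, GoodAt, val_fire, sched]
  · obtain ⟨h1, h2⟩ := hz
    obtain ⟨h3, h4⟩ := noise_factor_lt h2 hu
    -- Since `p` and `t` have the same age, the deadline of `p` is the end of the range of `t`;
    -- noise below 1 lets `t` win.
    simp only [stepAt, compete, h1, if_pos h4]
    simp [Good, hs, move, GoodAt, val_fire, sched, h1, add_lt_one h4]
    simpa using Or.inr (by simpa using h3)
  · obtain ⟨hc, ht, hp, hp1⟩ := hz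
    simp only [stepAt, compete]
    split_ifs with h
    · simp [Good, hs, move, GoodAt]
    · simp [Good, hs, move, GoodAt, val_fire, sched, hc, hp, hp1]
  · obtain ⟨hp, ht, hc, hc1⟩ := hz
    simp only [stepAt, compete]
    split_ifs with h
    · simp only [ht, tsub_zero, one_mul] at h
      have hm : move Transporting {t} = Consuming := by simp [move]
      simp only [Good, state_fire, hs, hm, GoodAt]
      exact Or.inl (by simp [hs, hm, val_fire, sched, ht, hp, hc, add_lt_one h])
    · simp [Good, hs, move, GoodAt, val_fire, sched, hp, ht, hc]
  · rcases hz with ⟨h1, h2⟩ | ⟨hc, hp, hp1⟩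
    · simp only [stepAt, if_pos h1]
      have h3 : z.val p + (1 - z.val c) < 1 :=
        calc z.val p + (1 - z.val c) < z.val c + (1 - z.val c) := by gcongr
          _ = 1 := add_tsub_cancel_of_le h2.le
      have hm : move Consuming {c} = Consuming := by simp [move]
      simp only [Good, state_fire, hs, hm, GoodAt]
      exact Or.inr (by simp [hs, hm, val_fire, sched, h2, h3])
    · have h1 : ¬ z.val p < z.val c := by simp [hc]
      simp only [stepAt, if_neg h1]
      simp [Good, hs, move, GoodAt, val_fire, sched, hc, hp, hp1]
  · simp [Good, stepAt, hs, move, GoodAt]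

/-- This reduces measurability of maps defined by cases on the state to measurability of each case.
-/
lemma measurable_of_countable_index {ι α β : Type*} [MeasurableSpace ι] [Countable ι]
    [MeasurableSingletonClass ι] [MeasurableSpace α] [MeasurableSpace β] {F : ι → α → β}
    {i : α → ι} (hi : Measurable i) (hF : ∀ j, Measurable (F j)) :
    Measurable fun a => F (i a) a :=
  (measurable_from_prod_countable_right (f := fun q : ι × α => F q.1 q.2) hF).comp
    (hi.prodMk measurable_id)

@[fun_prop]
lemma measurable_state : Measurable fun z : Cfg => z.state :=
  measurable_fst.comp measurable_subtype_coe

@[fun_prop]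
lemma measurable_val (e : PCEvent) : Measurable fun z : Cfg => z.val e :=
  (measurable_pi_apply e).comp (measurable_fst.comp (measurable_snd.comp measurable_subtype_coe))

lemma measurableSet_good : MeasurableSet {z : Cfg | Good z} := by
  refine measurableSet_setOfPred.2 (measurable_of_countable_index (F := GoodAt) measurable_state ?_)
  intro s
  have h0 (e) : MeasurableSet {z : Cfg | z.val e = 0} :=
    measurableSet_eq_fun (measurable_val e) measurable_const
  have h1 (e) : MeasurableSet {z : Cfg | z.val e < 1} :=
    measurableSet_lt (measurable_val e) measurable_const
  have h2 (e) : MeasurableSet {z : Cfg | 0 < z.val e} :=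
    measurableSet_lt measurable_const (measurable_val e)
  cases s
  · exact measurableSet_setOfPred.1 (h0 p)
  · exact measurableSet_setOfPred.1
      ((measurableSet_eq_fun (measurable_val p) (measurable_val t)).inter (h1 t))
  · exact measurableSet_setOfPred.1 ((h0 c).inter ((h0 t').inter ((h2 p).inter (h1 p))))
  · exact measurableSet_setOfPred.1 ((h0 p).inter ((h0 t).inter ((h2 c).inter (h1 c))))
  · exact measurableSet_setOfPred.1 (((measurableSet_lt (measurable_val p) (measurable_val c)).inter
      (h1 c)).union ((h0 c).inter ((h2 p).inter (h1 p))))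
  · exact measurable_const

@[fun_prop]
lemma measurable_fire_prod {α : Type*} [MeasurableSpace α] (A : Finset PCEvent) {f : α → Cfg}
    {g : α → ℝ≥0} (hf : Measurable f) (hg : Measurable g) :
    Measurable fun a => fire (f a) A (g a) := by
  refine Measurable.subtype_mk ?_
  have hm : Measurable fun a => move (f a).state A :=
    (measurable_of_finite fun s => move s A).comp (measurable_state.comp hf)
  refine hm.prodMk (Measurable.prodMk (measurable_pi_lambda _ fun e => ?_) hg)
  refine measurable_of_countable_index (i := fun a => (f a).state)
    (F := fun s a => if e ∈ sched (move s A) ∧ e ∈ sched s ∧ e ∉ A then (f a).val e + g a else 0)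
    (measurable_state.comp hf) fun s => ?_
  split_ifs
  · exact ((measurable_val e).comp hf).add hg
  · exact measurable_const

lemma measurable_compete (v f : PCEvent) :
    Measurable fun q : Cfg × ℝ => compete q.1 v f q.2 := by
  unfold compete
  exact Measurable.ite (measurableSet_lt (by fun_prop) (by fun_prop)) (by fun_prop) (by fun_prop)

theorem measurable_step : Measurable fun q : Cfg × ℝ => step q.1 q.2 := by
  refine measurable_of_countable_index (i := fun q : Cfg × ℝ => q.1.state)
    (F := fun s q => stepAt s q.1 q.2) (by fun_prop) fun s => ?_
  cases s
  · simp only [stepAt]; fun_prop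
  · exact measurable_compete t p
  · exact measurable_compete t' p
  · exact measurable_compete t c
  · exact Measurable.ite (measurableSet_lt (by fun_prop) (by fun_prop)) (by fun_prop) (by fun_prop)
  · simp only [stepAt]; fun_prop

lemma ae_good_step {z : Cfg} (hz : Good z) : ∀ᵐ u ∂noise, Good (step z u) :=
  (ae_restrict_iff' measurableSet_Ioo).2 (.of_forall fun _ hu => good_step hz hu)

lemma measurable_step_right (z : Cfg) : Measurable (step z) :=
  measurable_step.comp measurable_prodMk_left

lemma ae_good_transition {z : Cfg} (hz : Good z) :
    ∀ᵐ w ∂producerConsumer.transition z, Good w := by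
  rw [transition_eq hz]
  exact (ae_map_iff (measurable_step_right z).aemeasurable measurableSet_good).2 (ae_good_step hz)

end PC

/-! ### Uniqueness of the run measure, and prepending to an i.i.d. sequence -/

/-- Square cylinders form a π-system generating the product σ-field. Padding the missing coordinates
with `univ` makes each of them a cylinder over an initial segment, whose measure is prescribed. -/
lemma GSMP.IsRunMeasure.unique {S E : Type*} [Fintype S] [Fintype E] [DecidableEq E]
    [MeasurableSpace S] {G : GSMP S E} {Q Q' : Measure (ℕ → G.Config)} (h : G.IsRunMeasure Q)
    (h' : G.IsRunMeasure Q') : Q = Q' := by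
  classical
  have := h.isProbabilityMeasure
  have := h'.isProbabilityMeasure
  refine ext_of_generate_finite _ generateFrom_squareCylinders.symm
    (isPiSystem_squareCylinders (fun _ => MeasurableSpace.isPiSystem_measurableSet) (by simp))
    ?_ (by simp)
  rintro _ ⟨s, A, hA, rfl⟩
  have hA' : ∀ i, MeasurableSet (A i) := fun i => hA i (mem_univ i)
  have hs : (s : Set ℕ).pi A =
      {σ | ∀ i ≤ s.sup id, σ i ∈ if i ∈ s then A i else univ} := by
    ext σ
    simp only [mem_pi, Finset.mem_coe, mem_ofPred_eq]
    constructor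
    · intro hσ i _
      split_ifs with hi
      · exact hσ i hi
      · trivial
    · intro hσ i hi
      simpa [hi] using hσ i (Finset.le_sup (f := id) hi)
  have hm : ∀ i, MeasurableSet (if i ∈ s then A i else univ) := by
    intro i
    split_ifs
    · exact hA' i
    · exact MeasurableSet.univ
  rw [hs, h.cylinder _ _ hm, h'.cylinder _ _ hm]

/-- Prepending a value to a sequence. -/
def consSeq {α : Type*} (a : α) (u : ℕ → α) : ℕ → α
  | 0 => a
  | n + 1 => u n

lemma measurable_consSeq {α : Type*} [MeasurableSpace α] :
    Measurable fun q : α × (ℕ → α) => consSeq q.1 q.2 := by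
  refine measurable_pi_lambda _ fun n => ?_
  cases n with
  | zero => exact measurable_fst
  | succ n => exact (measurable_pi_apply n).comp measurable_snd

lemma map_consSeq_infinitePi {α : Type*} [MeasurableSpace α] (μ : Measure α)
    [IsProbabilityMeasure μ] :
    (μ.prod (Measure.infinitePi fun _ : ℕ => μ)).map (fun q => consSeq q.1 q.2) =
      Measure.infinitePi fun _ : ℕ => μ := by
  classical
  refine Measure.eq_infinitePi _ fun s A hA => ?_
  rw [Measure.map_apply measurable_consSeq (MeasurableSet.pi s.countable_toSet fun i _ => hA i)]
  set A' : ℕ → Set α := fun i => if i ∈ s then A i else univ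
  have hA' : ∀ i, MeasurableSet (A' i) := by
    intro i
    simp only [A']
    split_ifs
    · exact hA i
    · exact MeasurableSet.univ
  -- After the shift, the tail indices below `s.sup id` are the original coordinates `1, …, s.sup
  -- id`.
  have hset : (fun q : α × (ℕ → α) => consSeq q.1 q.2) ⁻¹' (s : Set ℕ).pi A =
      A' 0 ×ˢ (Finset.range (s.sup id) : Set ℕ).pi fun i => A' (i + 1) := by
    ext ⟨a, u⟩
    simp only [mem_preimage, mem_pi, Finset.mem_coe, mem_prod, Finset.mem_range]
    constructor
    · intro h
      have h' : ∀ i, consSeq a u i ∈ A' i := by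
        intro i
        simp only [A']
        split_ifs with hi
        · exact h i hi
        · trivial
      exact ⟨h' 0, fun i _ => h' (i + 1)⟩
    · rintro ⟨h0, h1⟩ i hi
      have hi' : consSeq a u i ∈ A' i := by
        cases i with
        | zero => exact h0
        | succ i => exact h1 i (Finset.le_sup (f := id) hi)
      simpa [A', hi] using hi'
  have hsub : s ⊆ Finset.range (s.sup id + 1) := fun i hi =>
    Finset.mem_range.2 (Nat.lt_succ_of_le (Finset.le_sup (f := id) hi))
  have hprod : ∏ i ∈ s, μ (A i) = ∏ i ∈ Finset.range (s.sup id + 1), μ (A' i) := by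
    rw [← Finset.prod_subset hsub]
    · exact Finset.prod_congr rfl fun i hi => by simp [A', hi]
    · intro i _ hi
      simp [A', hi]
  rw [hset, Measure.prod_prod, Measure.infinitePi_pi _ fun i _ => hA' (i + 1), hprod,
    Finset.prod_range_succ', mul_comm]

/-! ### Existence of the run measure, from independent noise -/

namespace PC

open PCState PCEvent GSMP

/-- The `n`-th configuration of the run from `z` with noise `u`. -/
noncomputable def run : ℕ → Cfg → (ℕ → ℝ) → Cfg
  | 0, z, _ => z
  | n + 1, z, u => run n (step z (u 0)) fun i => u (i + 1)

lemma measurable_run (n : ℕ) : Measurable fun q : Cfg × (ℕ → ℝ) => run n q.1 q.2 := by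
  induction n with
  | zero => exact measurable_fst
  | succ n ih =>
    have h1 : Measurable fun q : Cfg × (ℕ → ℝ) => step q.1 (q.2 0) :=
      measurable_step.comp
        (measurable_fst.prodMk ((measurable_pi_apply 0).comp measurable_snd))
    have h2 : Measurable fun q : Cfg × (ℕ → ℝ) => fun i => q.2 (i + 1) :=
      measurable_pi_lambda _ fun i => (measurable_pi_apply (i + 1)).comp measurable_snd
    exact ih.comp (h1.prodMk h2)

/-- The law of the noise sequence. -/
noncomputable abbrev noiseSeq : Measure (ℕ → ℝ) := Measure.infinitePi fun _ => noise

lemma measurableSet_run_mem (n : ℕ) {A : ℕ → Set Cfg} (hA : ∀ i, MeasurableSet (A i)) :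
    MeasurableSet {q : Cfg × (ℕ → ℝ) | ∀ i < n, run (i + 1) q.1 q.2 ∈ A i} := by
  have : {q : Cfg × (ℕ → ℝ) | ∀ i < n, run (i + 1) q.1 q.2 ∈ A i} =
      ⋂ i, ⋂ (_ : i < n), (fun q : Cfg × (ℕ → ℝ) => run (i + 1) q.1 q.2) ⁻¹' A i := by
    ext; simp
  rw [this]
  exact MeasurableSet.iInter fun i => MeasurableSet.iInter fun _ => measurable_run (i + 1) (hA i)

/-- The first noise variable is independent of the remaining sequence, which has the same law, so
both sides satisfy the same recursion (Markov property). -/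
theorem pathWeight_eq (n : ℕ) {A : ℕ → Set Cfg} (hA : ∀ i, MeasurableSet (A i)) {z : Cfg}
    (hz : Good z) :
    producerConsumer.pathWeight n A z = noiseSeq {u | ∀ i < n, run (i + 1) z u ∈ A i} := by
  induction n generalizing A z with
  | zero => simp [pathWeight]
  | succ n ih =>
    have hA' : ∀ i, MeasurableSet (A (i + 1)) := fun i => hA (i + 1)
    set g : Cfg → ℝ≥0∞ := fun w => noiseSeq {u | ∀ i < n, run (i + 1) w u ∈ A (i + 1)}
    have hg : Measurable g := measurable_measure_prodMk_left (measurableSet_run_mem n hA')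
    have hS : MeasurableSet {u : ℕ → ℝ | ∀ i < n + 1, run (i + 1) z u ∈ A i} :=
      measurable_prodMk_left (measurableSet_run_mem (n + 1) hA)
    calc producerConsumer.pathWeight (n + 1) A z
        = ∫⁻ w in A 0, g w ∂producerConsumer.transition z := by
          -- The induction hypothesis covers good successors only, and almost every successor is
          -- good. Replacing `pathWeight` by `g` also supplies the measurability needed below.
          refine lintegral_congr_ae (ae_restrict_of_ae ?_)
          filter_upwards [ae_good_transition hz] with w hw using ih hA' hw
      _ = ∫⁻ a, (A 0).indicator g (step z a) ∂noise := by
          rw [← lintegral_indicator (hA 0), transition_eq hz,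
            lintegral_map (hg.indicator (hA 0)) (measurable_step_right z)]
      _ = _ := by
          conv_rhs => rw [noiseSeq, ← map_consSeq_infinitePi noise]
          rw [Measure.map_apply measurable_consSeq hS,
            Measure.prod_apply (measurable_consSeq hS)]
          refine lintegral_congr fun a => ?_
          have hiff : ∀ u, (∀ i < n + 1, run (i + 1) z (consSeq a u) ∈ A i) ↔
              step z a ∈ A 0 ∧ ∀ i < n, run (i + 1) (step z a) u ∈ A (i + 1) := by
            intro u
            refine ⟨fun h => ⟨h 0 (Nat.succ_pos n), fun i hi => h (i + 1) (by lia)⟩, ?_⟩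
            rintro ⟨h0, h1⟩ (_ | i) hi
            · exact h0
            · exact h1 i (by lia)
          simp only [preimage, mem_ofPred_eq, hiff]
          by_cases ha : step z a ∈ A 0 <;> simp [ha, g]

/-- The initial configuration. -/
noncomputable abbrev startCfg : Cfg := producerConsumer.zeroConfig Init

lemma good_startCfg : Good startCfg := rfl

lemma initialMeasure_eq : producerConsumer.initialMeasure = Measure.dirac startCfg := by
  change ∑ s : PCState, PMF.pure Init s • Measure.dirac (producerConsumer.zeroConfig s) = _
  rw [Finset.sum_eq_single Init]
  · simp
  · intro b _ hb
    simp [hb]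
  · simp

theorem isRunMeasure_map_run :
    producerConsumer.IsRunMeasure (noiseSeq.map fun u n => run n startCfg u) := by
  have hm : Measurable fun (u : ℕ → ℝ) n => run n startCfg u :=
    measurable_pi_lambda _ fun n => (measurable_run n).comp measurable_prodMk_left
  refine ⟨Measure.isProbabilityMeasure_map hm.aemeasurable, fun n A hA => ?_⟩
  have hS : MeasurableSet {σ : ℕ → Cfg | ∀ i ≤ n, σ i ∈ A i} := by
    have : {σ : ℕ → Cfg | ∀ i ≤ n, σ i ∈ A i} = (Iic n).pi A := by ext; simp [mem_pi]
    rw [this]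
    exact MeasurableSet.pi (to_countable _) fun i _ => hA i
  classical
  rw [Measure.map_apply hm hS, initialMeasure_eq, setLIntegral_dirac,
    pathWeight_eq n (fun i => hA (i + 1)) good_startCfg]
  have hiff : ∀ u, (∀ i ≤ n, run i startCfg u ∈ A i) ↔
      startCfg ∈ A 0 ∧ ∀ i < n, run (i + 1) startCfg u ∈ A (i + 1) := by
    intro u
    refine ⟨fun h => ⟨h 0 (Nat.zero_le n), fun i hi => h (i + 1) (by lia)⟩, ?_⟩
    rintro ⟨h0, h1⟩ (_ | i) hi
    · exact h0
    · exact h1 i (by lia)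
  simp only [preimage, mem_ofPred_eq, hiff]
  by_cases h0 : startCfg ∈ A 0 <;> simp [h0]

theorem existsUnique_runMeasure :
    ∃! Q : Measure (ℕ → Cfg), producerConsumer.IsRunMeasure Q :=
  ⟨_, isRunMeasure_map_run, fun _ hQ => hQ.unique isRunMeasure_map_run⟩

end PC

/-! ### A lower bound for the probability of avoiding `Sink` -/

namespace PC

open PCState PCEvent GSMP

/-- The probability, in the state `s`, of never reaching `Sink`. -/
noncomputable def avoidProbAt (s : PCState) (z : Cfg) : ℝ :=
  match s with
  | Init => Real.exp (-1)
  | CWaiting => Real.exp (z.val t - 1)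
  | Delivered => z.val p * Real.exp (z.val p - 1)
  | Transporting => Real.exp (-z.val c)
  | Consuming =>
    if z.val p < z.val c then Real.exp (z.val p - z.val c) else Real.exp (z.val p - 1)
  | Sink => 0

/-- The probability of never reaching `Sink`. -/
noncomputable def avoidProb (z : Cfg) : ℝ := avoidProbAt z.state z

lemma measurable_avoidProb : Measurable avoidProb := by
  refine measurable_of_countable_index (F := avoidProbAt) measurable_state fun s => ?_
  cases s
  · exact measurable_const
  · exact (by fun_prop : Measurable fun z : Cfg => Real.exp (z.val t - 1))
  · exact (by fun_prop : Measurable fun z : Cfg => (z.val p : ℝ) * Real.exp (z.val p - 1))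
  · exact (by fun_prop : Measurable fun z : Cfg => Real.exp (-z.val c))
  · exact Measurable.ite (measurableSet_lt (by fun_prop) (by fun_prop)) (by fun_prop) (by fun_prop)
  · exact measurable_const

lemma avoidProb_le_one {z : Cfg} (hz : Good z) : avoidProb z ≤ 1 := by
  rw [Good] at hz
  rw [avoidProb]
  rcases hs : z.state <;> rw [hs] at hz <;> simp only [avoidProbAt]
  · simp
  · have h : (z.val t : ℝ) < 1 := by exact_mod_cast hz.2
    exact Real.exp_le_one_iff.2 (by linarith)
  · have h : (z.val p : ℝ) < 1 := by exact_mod_cast hz.2.2.2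
    exact mul_le_one₀ h.le (Real.exp_nonneg _) (Real.exp_le_one_iff.2 (by linarith))
  · simp
  · split_ifs with h
    · have h : (z.val p : ℝ) < z.val c := by exact_mod_cast h
      exact Real.exp_le_one_iff.2 (by linarith)
    · rcases hz with hz | hz
      · exact absurd hz.1 h
      · have h : (z.val p : ℝ) < 1 := by exact_mod_cast hz.2.2
        exact Real.exp_le_one_iff.2 (by linarith)
  · simp

/-- This is the equation `h a = (1 - a)⁻¹ * ∫ y in a..1, y * h y` for `h y = exp (y - 1)`, after
substituting `y = a + (1 - a) * u`. An antiderivative of `y * exp (y - 1)` is `(y - 1) * exp (y -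
1)`. -/
lemma integral_waiting (a : ℝ) (ha : a < 1) :
    ∫ u in Ioo (0 : ℝ) 1, (a + (1 - a) * u) * Real.exp (a + (1 - a) * u - 1) =
      Real.exp (a - 1) := by
  have hd : ∀ u ∈ uIcc (0 : ℝ) 1, HasDerivAt
      (fun u => (1 - a)⁻¹ * ((a + (1 - a) * u - 1) * Real.exp (a + (1 - a) * u - 1)))
      ((a + (1 - a) * u) * Real.exp (a + (1 - a) * u - 1)) u := by
    intro u _
    have h1 : HasDerivAt (fun u : ℝ => a + (1 - a) * u - 1) (1 - a) u := by
      simpa using (((hasDerivAt_id u).const_mul (1 - a)).const_add a).sub_const 1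
    refine ((h1.mul h1.exp).const_mul (1 - a)⁻¹).congr_deriv ?_
    have : 1 - a ≠ 0 := (sub_pos.2 ha).ne'
    field_simp
    ring
  rw [← integral_Ioc_eq_integral_Ioo, ← intervalIntegral.integral_of_le zero_le_one,
    intervalIntegral.integral_eq_sub_of_hasDerivAt hd
      (Continuous.intervalIntegrable (by fun_prop) _ _)]
  have : 1 - a ≠ 0 := (sub_pos.2 ha).ne'
  simp only [mul_one, mul_zero, add_zero, add_sub_cancel, sub_self, zero_mul, zero_sub]
  field_simp
  ring

/-- In `Init`, `Transporting` and `Consuming` the step preserves the phase, so `avoidProb` does not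
change. In `CWaiting` the phase is redrawn and `integral_waiting` applies; in `Delivered` the factor
`z.val p` is the probability of surviving. -/
theorem avoidProb_le_lintegral {z : Cfg} (hz : Good z) :
    ENNReal.ofReal (avoidProb z) ≤ ∫⁻ u, ENNReal.ofReal (avoidProb (step z u)) ∂noise := by
  have hconst : (∀ u ∈ Ioo (0 : ℝ) 1, avoidProb (step z u) = avoidProb z) →
      ENNReal.ofReal (avoidProb z) ≤ ∫⁻ u, ENNReal.ofReal (avoidProb (step z u)) ∂noise := by
    intro h
    rw [setLIntegral_congr_fun measurableSet_Ioo (fun u hu => congrArg ENNReal.ofReal (h u hu))]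
    simp
  have step_eq : ∀ u, step z u = stepAt z.state z u := fun _ => rfl
  rw [Good] at hz
  rcases hs : z.state <;> rw [hs] at hz step_eq
  · refine hconst fun u _ => ?_
    have hm : move Init {p} = CWaiting := by simp [move]
    rw [step_eq, stepAt, avoidProb, avoidProb, state_fire, hs, hm]
    simp [avoidProbAt, val_fire, hs, hm, sched]
  · obtain ⟨h1, h2⟩ := hz
    have hm : move CWaiting {t} = Delivered := by simp [move]
    have h3 : (z.val t : ℝ) < 1 := by exact_mod_cast h2
    have hval : ∀ u ∈ Ioo (0 : ℝ) 1, avoidProb (step z u) =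
        (z.val t + (1 - z.val t) * u) * Real.exp (z.val t + (1 - z.val t) * u - 1) := by
      intro u hu
      have h4 := (noise_factor_lt h2 hu).2
      rw [step_eq, stepAt, compete, h1, if_pos h4, avoidProb, state_fire, hs, hm]
      simp [avoidProbAt, val_fire, hs, hm, sched, h1, NNReal.coe_sub h2.le,
        Real.coe_toNNReal _ hu.1.le]
    rw [setLIntegral_congr_fun measurableSet_Ioo
        (fun u hu => congrArg ENNReal.ofReal (hval u hu)),
      ← ofReal_integral_eq_lintegral_ofReal, integral_waiting _ h3, avoidProb, hs, avoidProbAt]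
    · exact (Continuous.integrableOn_Icc (by fun_prop)).mono_set Ioo_subset_Icc_self
    · refine (ae_restrict_iff' measurableSet_Ioo).2 (.of_forall fun u hu => ?_)
      have : (0 : ℝ) ≤ (1 - z.val t) * u := mul_nonneg (by linarith) hu.1.le
      exact mul_nonneg (add_nonneg (NNReal.coe_nonneg _) this) (Real.exp_nonneg _)
  · obtain ⟨hc, ht, hp, hp1⟩ := hz
    have hm : move Delivered {p} = Transporting := by simp [move]
    have hp1' : (z.val p : ℝ) < 1 := by exact_mod_cast hp1
    -- On this interval, of length `z.val p`, the event `p` precedes the failure `t'`. The remaining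
    -- noise is discarded, which suffices for a lower bound.
    have hval : ∀ u ∈ Ioo (1 - z.val p : ℝ) 1,
        avoidProb (step z u) = Real.exp (z.val p - 1) := by
      intro u hu
      have h : ¬ (1 - z.val t') * u.toNNReal < 1 - z.val p := by
        rw [ht, tsub_zero, one_mul, not_lt]
        refine NNReal.coe_le_coe.1 ?_
        rw [NNReal.coe_sub hp1.le, Real.coe_toNNReal _ (by linarith [hu.1])]
        exact hu.1.le
      rw [step_eq, stepAt, compete, if_neg h, avoidProb, state_fire, hs, hm]
      simp [avoidProbAt, val_fire, hs, hm, sched, hc, NNReal.coe_sub hp1.le]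
    calc ENNReal.ofReal (avoidProb z)
        = ∫⁻ u in Ioo (1 - z.val p : ℝ) 1, ENNReal.ofReal (avoidProb (step z u)) := by
          rw [setLIntegral_congr_fun measurableSet_Ioo
            (fun u hu => congrArg ENNReal.ofReal (hval u hu)), avoidProb, hs, avoidProbAt,
            setLIntegral_const, Real.volume_Ioo, ← ENNReal.ofReal_mul (Real.exp_nonneg _)]
          congr 1
          ring
      _ ≤ _ := lintegral_mono_set (Ioo_subset_Ioo_left (by linarith))
  · refine hconst fun u hu => ?_
    obtain ⟨hp, ht, hc, hc1⟩ := hz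
    have hm : move Transporting {t} = Consuming := by simp [move]
    have hm' : move Transporting {c} = CWaiting := by simp [move]
    rw [step_eq, stepAt, compete, avoidProb, avoidProb, hs]
    split_ifs with h
    · rw [state_fire, hs, hm]
      simp [avoidProbAt, val_fire, hs, hm, sched, hp, ht, hc]
    · rw [state_fire, hs, hm']
      simp [avoidProbAt, val_fire, hs, hm', sched, ht, NNReal.coe_sub hc1.le]
  · refine hconst fun u hu => ?_
    have hm : move Consuming {c} = Consuming := by simp [move]
    have hm' : move Consuming {p} = Transporting := by simp [move]
    rcases hz with ⟨h1, h2⟩ | ⟨hc, hp, hp1⟩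
    · rw [step_eq, stepAt, if_pos h1, avoidProb, avoidProb, state_fire, hs, hm]
      simp [avoidProbAt, val_fire, hs, hm, sched, h1, NNReal.coe_sub h2.le]
      ring
    · have h1 : ¬ z.val p < z.val c := by simp [hc]
      rw [step_eq, stepAt, if_neg h1, avoidProb, avoidProb, state_fire, hs, hm']
      simp [avoidProbAt, val_fire, hs, hm', sched, hc, NNReal.coe_sub hp1.le]
  · simp [avoidProb, hs, avoidProbAt]

/-- Good configurations with a state other than `Sink`. -/
def goodAvoiding : Set Cfg := {z | Good z ∧ z.state ≠ Sink}

lemma measurableSet_goodAvoiding : MeasurableSet goodAvoiding :=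
  measurableSet_good.inter (measurable_state (measurableSet_singleton Sink).compl)

/-- A function that is at most 1, vanishes on `Sink` and does not exceed its one-step mean is
bounded by the probability of staying outside `Sink` for `n` steps. -/
lemma avoidProb_le_pathWeight (n : ℕ) {z : Cfg} (hz : Good z) :
    ENNReal.ofReal (avoidProb z) ≤ producerConsumer.pathWeight n (fun _ => goodAvoiding) z := by
  induction n generalizing z with
  | zero =>
    rw [pathWeight]
    exact ENNReal.ofReal_le_one.2 (avoidProb_le_one hz)
  | succ n ih =>
    calc ENNReal.ofReal (avoidProb z)
        ≤ ∫⁻ u, ENNReal.ofReal (avoidProb (step z u)) ∂noise := avoidProb_le_lintegral hz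
      _ = ∫⁻ w, ENNReal.ofReal (avoidProb w) ∂producerConsumer.transition z := by
          rw [transition_eq hz,
            lintegral_map measurable_avoidProb.ennreal_ofReal (measurable_step_right z)]
      _ ≤ ∫⁻ w, goodAvoiding.indicator
            (fun w => producerConsumer.pathWeight n (fun _ => goodAvoiding) w) w
            ∂producerConsumer.transition z := by
          refine lintegral_mono_ae ?_
          filter_upwards [ae_good_transition hz] with w hw
          by_cases hsink : w.state = Sink
          · simp [avoidProb, hsink, avoidProbAt]
          · rw [indicator_of_mem (show w ∈ goodAvoiding from ⟨hw, hsink⟩)]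
            exact ih hw
      _ = _ := by rw [lintegral_indicator measurableSet_goodAvoiding, pathWeight]

theorem exp_neg_one_le_measure {Q : Measure (ℕ → Cfg)} (hQ : producerConsumer.IsRunMeasure Q) :
    ENNReal.ofReal (Real.exp (-1)) ≤ Q {σ | ∀ n, σ n ∈ goodAvoiding} := by
  have := hQ.isProbabilityMeasure
  have hcyl : ∀ n, ENNReal.ofReal (Real.exp (-1)) ≤ Q {σ | ∀ i ≤ n, σ i ∈ goodAvoiding} := by
    intro n
    have hstart : startCfg ∈ goodAvoiding := ⟨good_startCfg, nofun⟩
    classical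
    rw [hQ.cylinder n (fun _ => goodAvoiding) fun _ => measurableSet_goodAvoiding,
      initialMeasure_eq, setLIntegral_dirac, if_pos hstart]
    exact avoidProb_le_pathWeight n good_startCfg
  have hm : ∀ n, MeasurableSet {σ : ℕ → Cfg | ∀ i ≤ n, σ i ∈ goodAvoiding} := by
    intro n
    have : {σ : ℕ → Cfg | ∀ i ≤ n, σ i ∈ goodAvoiding} = (Iic n).pi fun _ => goodAvoiding := by
      ext; simp [mem_pi]
    rw [this]
    exact MeasurableSet.pi (to_countable _) fun _ _ => measurableSet_goodAvoiding
  have hset : {σ : ℕ → Cfg | ∀ n, σ n ∈ goodAvoiding} =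
      ⋂ n, {σ | ∀ i ≤ n, σ i ∈ goodAvoiding} := by
    ext σ
    simp only [mem_ofPred_eq, mem_iInter]
    exact ⟨fun h _ i _ => h i, fun h n => h n n le_rfl⟩
  have hanti : Antitone fun n => {σ : ℕ → Cfg | ∀ i ≤ n, σ i ∈ goodAvoiding} :=
    fun _ _ hnk _ h i hi => h i (hi.trans hnk)
  rw [hset, hanti.measure_iInter (fun n => (hm n).nullMeasurableSet) ⟨0, measure_ne_top _ _⟩]
  exact le_iInf hcyl

/-- The set `X` may be non-measurable: it lies in the complement of a measurable set of positive
measure. -/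
lemma measure_lt_one_of_not_goodAvoiding {Q : Measure (ℕ → Cfg)}
    (hQ : producerConsumer.IsRunMeasure Q) {X : Set (ℕ → Cfg)}
    (hX : ∀ σ ∈ X, ∃ n, σ n ∉ goodAvoiding) : Q X < 1 := by
  have := hQ.isProbabilityMeasure
  have hm : MeasurableSet {σ : ℕ → Cfg | ∀ n, σ n ∈ goodAvoiding} := by
    have : {σ : ℕ → Cfg | ∀ n, σ n ∈ goodAvoiding} = univ.pi fun _ => goodAvoiding := by
      ext; simp [mem_pi]
    rw [this]
    exact MeasurableSet.univ_pi fun _ => measurableSet_goodAvoiding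
  have hsub : X ⊆ {σ : ℕ → Cfg | ∀ n, σ n ∈ goodAvoiding}ᶜ := by
    intro σ hσ h
    obtain ⟨n, hn⟩ := hX σ hσ
    exact hn (h n)
  refine (measure_mono hsub).trans_lt ?_
  rw [prob_compl_eq_one_sub hm]
  refine ENNReal.sub_lt_self ENNReal.one_ne_top one_ne_zero fun h0 => ?_
  have := exp_neg_one_le_measure hQ
  rw [h0, nonpos_iff_eq_zero, ENNReal.ofReal_eq_zero] at this
  exact absurd (Real.exp_pos (-1)) this.not_gt

end PC

/-! ### The infinite product -/

/-- The product `∏ (1 - 2⁻ⁱ)²ⁱ` converges to a positive number, at most its first factor. -/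
theorem hasProd_one_sub_half_pow :
    ∃ m : ℝ, 0 < m ∧ m ≤ 1 / 4 ∧
      HasProd (fun i : ℕ => (1 - (1 / 2 : ℝ) ^ (i + 1)) ^ (2 * (i + 1))) m := by
  have hhalf : ∀ i : ℕ, (1 / 2 : ℝ) ^ (i + 1) ≤ 1 / 2 := fun i => by
    rw [pow_succ]
    have : (1 / 2 : ℝ) ^ i ≤ 1 := pow_le_one₀ (by norm_num) (by norm_num)
    linarith
  have hpos : ∀ i : ℕ, 0 < 1 - (1 / 2 : ℝ) ^ (i + 1) := fun i => by linarith [hhalf i]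
  have hpos' : ∀ i : ℕ, 0 < (1 - (1 / 2 : ℝ) ^ (i + 1)) ^ (2 * (i + 1)) :=
    fun i => pow_pos (hpos i) _
  have hlog : ∀ i : ℕ, Real.log ((1 - (1 / 2 : ℝ) ^ (i + 1)) ^ (2 * (i + 1))) ≤ 0 := fun i =>
    Real.log_nonpos (hpos' i).le
      (pow_le_one₀ (hpos i).le (sub_le_self _ (by positivity)))
  -- The bound `-log (1 - x) ≤ 2 * x` for `0 < x ≤ 1/2`, times the exponent `2 * (i + 1)`, gives the
  -- constant 4.
  have hgeom : Summable fun i : ℕ => 4 * (((i + 1 : ℕ) : ℝ) ^ 1 * (1 / 2 : ℝ) ^ (i + 1)) :=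
    ((summable_nat_add_iff 1).2
      (summable_pow_mul_geometric_of_norm_lt_one 1 (r := (1 / 2 : ℝ)) (by norm_num))).mul_left 4
  have hsum : Summable fun i : ℕ => Real.log ((1 - (1 / 2 : ℝ) ^ (i + 1)) ^ (2 * (i + 1))) := by
    refine Summable.of_norm_bounded hgeom fun i => ?_
    rw [Real.norm_of_nonpos (hlog i), Real.log_pow]
    have h1 := Real.one_sub_inv_le_log_of_pos (hpos i)
    set x := (1 / 2 : ℝ) ^ (i + 1)
    have hx : x ≤ 1 / 2 := hhalf i
    have hx0 : 0 < x := by positivity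
    have h2 : (1 - x)⁻¹ ≤ 1 + 2 * x := by
      rw [inv_le_iff_one_le_mul₀ (by linarith)]
      nlinarith
    have h3 : - Real.log (1 - x) ≤ 2 * x := by linarith
    push_cast
    have : (0 : ℝ) ≤ (i : ℝ) + 1 := by positivity
    nlinarith
  refine ⟨_, Real.exp_pos _, ?_, Real.hasProd_of_hasSum_log hpos' hsum.hasSum⟩
  rw [← Real.exp_log (show (0 : ℝ) < 1 / 4 by norm_num), Real.exp_le_exp]
  -- All logarithms are nonpositive, so their sum is at most the term with index 0, which is `log
  -- (1/4)`.
  have h0 := hsum.neg.le_tsum 0 fun i _ => neg_nonneg.2 (hlog i)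
  rw [tsum_neg] at h0
  norm_num at h0 ⊢
  linarith

/-! ### Regions of the example and invariance of the constraints -/

namespace PC

open PCState PCEvent GSMP

lemma maxBound_eq : producerConsumer.maxBound = 1 := by
  refine le_antisymm (Finset.sup_le fun e _ => max_le ?_ le_rfl) ?_
  · change lower e ≤ 1
    cases e <;> simp [lower]
  · exact (le_max_left 1 _).trans (Finset.le_sup (f := fun e =>
      max (producerConsumer.lower e) (producerConsumer.upper e).toNat) (Finset.mem_univ p))

/-- Below 1 the integral part is 0 and a number is its own fractional part. Since `maxBound` is 1,
regions there are described by which ages vanish and how the ages are ordered. -/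
lemma agreeIntegral_iff {a b : ℝ≥0} (ha : a < 1) :
    AgreeIntegral a b ↔ b < 1 ∧ (a = 0 ↔ b = 0) := by
  have fl : ∀ {x : ℝ≥0}, x < 1 ↔ ⌊(x : ℝ)⌋ = 0 := by
    intro x
    rw [Int.floor_eq_zero_iff, mem_Ico]
    simp
  have fr : ∀ {x : ℝ≥0}, x < 1 → Int.fract (x : ℝ) = x := fun {x} hx =>
    Int.fract_eq_self.2 ⟨x.coe_nonneg, by exact_mod_cast hx⟩
  rw [AgreeIntegral, fl.1 ha, eq_comm, ← fl]
  refine and_congr_right fun hb => ?_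
  rw [fr ha, fr hb]
  simp

lemma fract_le_iff {a b : ℝ≥0} (ha : a < 1) (hb : b < 1) :
    Int.fract (a : ℝ) ≤ Int.fract (b : ℝ) ↔ a ≤ b := by
  rw [Int.fract_eq_self.2 ⟨a.coe_nonneg, by exact_mod_cast ha⟩,
    Int.fract_eq_self.2 ⟨b.coe_nonneg, by exact_mod_cast hb⟩, NNReal.coe_le_coe]

lemma regionRel_lt_one {z w : Cfg} (h : producerConsumer.RegionRel z w) {e : PCEvent}
    (he : e ∈ sched z.state) (hz : z.val e < 1) :
    w.val e < 1 ∧ (z.val e = 0 ↔ w.val e = 0) := by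
  rcases h.agree e he with h1 | h1
  · exact (agreeIntegral_iff hz).1 h1
  · rw [maxBound_eq, Nat.cast_one] at h1
    exact absurd (show (z.val e : ℝ) < 1 by exact_mod_cast hz) h1.1.not_gt

lemma regionRel_le_iff {z w : Cfg} (h : producerConsumer.RegionRel z w) {e f : PCEvent}
    (he : e ∈ sched z.state) (hf : f ∈ sched z.state) (hz : z.val e < 1) (hz' : z.val f < 1) :
    z.val e ≤ z.val f ↔ w.val e ≤ w.val f := by
  have h1 := h.order e he f hf (by rw [maxBound_eq]; exact_mod_cast hz.le)
    (by rw [maxBound_eq]; exact_mod_cast hz'.le)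
  rwa [fract_le_iff hz hz',
    fract_le_iff (regionRel_lt_one h he hz).1 (regionRel_lt_one h hf hz').1] at h1

lemma region_eq_of_lt_one {z w : Cfg} (hs : z.state = w.state)
    (h1 : ∀ e ∈ sched z.state, z.val e < 1 ∧ w.val e < 1 ∧ (z.val e = 0 ↔ w.val e = 0))
    (h2 : ∀ e ∈ sched z.state, ∀ f ∈ sched z.state,
      (z.val e ≤ z.val f ↔ w.val e ≤ w.val f)) :
    producerConsumer.region z = producerConsumer.region w := by
  refine Quotient.sound (s := producerConsumer.regionSetoid) ⟨hs, fun e he => ?_, ?_⟩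
  · exact Or.inl ((agreeIntegral_iff (h1 e he).1).2 (h1 e he).2)
  · intro e he f hf _ _
    rw [fract_le_iff (h1 e he).1 (h1 f hf).1, fract_le_iff (h1 e he).2.1 (h1 f hf).2.1]
    exact h2 e he f hf

lemma regionRel_of_region_eq {z w : Cfg}
    (h : producerConsumer.region z = producerConsumer.region w) :
    producerConsumer.RegionRel z w :=
  Quotient.exact (s := producerConsumer.regionSetoid) h

/-- The constraints on the elapsed times only depend on the region. -/
lemma good_of_regionRel {z w : Cfg} (h : producerConsumer.RegionRel z w) (hz : Good z) :
    Good w := by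
  have lt1 : ∀ {e : PCEvent}, e ∈ sched z.state → z.val e < 1 →
    w.val e < 1 ∧ (z.val e = 0 ↔ w.val e = 0) := fun he => regionRel_lt_one h he
  have le : ∀ {e f : PCEvent}, e ∈ sched z.state → f ∈ sched z.state → z.val e < 1 →
    z.val f < 1 → (z.val e ≤ z.val f ↔ w.val e ≤ w.val f) :=
    fun he hf => regionRel_le_iff h he hf
  rw [Good] at hz
  rw [Good, ← h.state_eq]
  rcases hs : z.state <;> rw [hs] at hz lt1 le
  · exact (lt1 (e := p) (by simp [sched]) (hz.trans_lt one_pos)).2.1 hz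
  · obtain ⟨h1, h2⟩ := hz
    have hp : p ∈ sched CWaiting := by simp [sched]
    have ht : t ∈ sched CWaiting := by simp [sched]
    exact ⟨le_antisymm ((le hp ht (h1.trans_lt h2) h2).1 h1.le)
      ((le ht hp h2 (h1.trans_lt h2)).1 h1.ge), (lt1 ht h2).1⟩
  · obtain ⟨hc, ht, hp, hp1⟩ := hz
    have kc := lt1 (e := c) (by simp [sched]) (hc.trans_lt one_pos)
    have kt := lt1 (e := t') (by simp [sched]) (ht.trans_lt one_pos)
    have kp := lt1 (e := p) (by simp [sched]) hp1
    exact ⟨kc.2.1 hc, kt.2.1 ht, pos_iff_ne_zero.2 fun h0 => hp.ne' (kp.2.2 h0), kp.1⟩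
  · obtain ⟨hp, ht, hc, hc1⟩ := hz
    have kp := lt1 (e := p) (by simp [sched]) (hp.trans_lt one_pos)
    have kt := lt1 (e := t) (by simp [sched]) (ht.trans_lt one_pos)
    have kc := lt1 (e := c) (by simp [sched]) hc1
    exact ⟨kp.2.1 hp, kt.2.1 ht, pos_iff_ne_zero.2 fun h0 => hc.ne' (kc.2.2 h0), kc.1⟩
  · have hp : p ∈ sched Consuming := by simp [sched]
    have hc : c ∈ sched Consuming := by simp [sched]
    rcases hz with ⟨h1, h2⟩ | ⟨h1, h2, h3⟩
    · refine Or.inl ⟨?_, (lt1 hc h2).1⟩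
      have := (le hc hp h2 (h1.trans h2)).not
      exact not_le.1 (this.1 (not_le.2 h1))
    · have kp := lt1 hp h3
      have kc := lt1 hc (h1.trans_lt one_pos)
      exact Or.inr ⟨kc.2.1 h1, pos_iff_ne_zero.2 fun h0 => h2.ne' (kp.2.2 h0), kp.1⟩
  · trivial

lemma exists_mem_of_ae {α : Type*} [MeasurableSpace α] {μ : Measure α} {s : Set α}
    {P : α → Prop} (hs : 0 < μ s) (h : ∀ᵐ x ∂μ, P x) : ∃ x ∈ s, P x := by
  by_contra! hcon
  exact hs.ne' (measure_mono_null (fun x hx => hcon x hx) (ae_iff.1 h))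

/-- The edge may start at another configuration of the region of `z`, but that one is good as well,
and a set of positive transition probability contains a good successor. -/
lemma exists_good_of_regionEdge {z : Cfg} (hz : Good z) {R : producerConsumer.Region}
    (h : producerConsumer.RegionEdge (producerConsumer.region z) R) :
    ∃ w, Good w ∧ producerConsumer.region w = R := by
  obtain ⟨w, hw, hpos⟩ := h
  have hgw : Good w := good_of_regionRel (regionRel_of_region_eq hw.symm) hz
  obtain ⟨x, hx, hgx⟩ := exists_mem_of_ae hpos (ae_good_transition hgw)
  exact ⟨x, hgx, hx⟩

lemma exists_good_of_regionReachable {R : producerConsumer.Region}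
    (h : producerConsumer.RegionReachable R) :
    ∃ w, Good w ∧ producerConsumer.region w = R := by
  obtain ⟨s, hs, hR⟩ := h
  have hs' : s = Init := by
    by_contra hne
    exact hs (by change PMF.pure Init s = 0; simp [hne])
  subst hs'
  induction hR with
  | refl => exact ⟨startCfg, good_startCfg, rfl⟩
  | tail _ hedge ih =>
    obtain ⟨w, hw, rfl⟩ := ih
    exact exists_good_of_regionEdge hw hedge

/-! ### The only BSCC that contains a good region -/

/-- The region of the configuration with state `Sink` and zero elapsed times. -/
noncomputable def sinkRegion : producerConsumer.Region :=
  producerConsumer.region (producerConsumer.zeroConfig Sink)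

/-- Whatever its age was, `p` occurs and restarts from 0, so `Sink` enters this region after one
step and stays in it. -/
lemma region_step_sink {z : Cfg} (hs : z.state = Sink) (u : ℝ) :
    producerConsumer.region (step z u) = sinkRegion := by
  have hm : move Sink {p} = Sink := by simp [move]
  have hst : step z u = fire z {p} (1 - z.val p) := by
    change stepAt z.state z u = _
    rw [hs, stepAt]
  have h0 : ∀ e ∈ sched Sink, (step z u).val e = 0 := by
    intro e he
    rw [hst]
    cases e <;> simp [sched] at he
    simp [val_fire]
  have h0' : ∀ e, (producerConsumer.zeroConfig Sink : Cfg).val e = 0 := fun _ => rfl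
  have hstate : (step z u).state = Sink := by rw [hst, state_fire, hs, hm]
  refine region_eq_of_lt_one hstate ?_ ?_ <;> rw [hstate]
  · intro e he
    simp [h0 e he, h0' e]
  · intro e he f hf
    simp [h0 e he, h0 f hf, h0']

/-- An edge needs positive probability, and an interval of noise whose outcomes all lie in one
region provides it. -/
lemma regionEdge_of_Ioo {z : Cfg} (hz : Good z) {R : producerConsumer.Region} {a b : ℝ}
    (ha : 0 ≤ a) (hb : b ≤ 1) (hab : a < b)
    (h : ∀ u ∈ Ioo a b, producerConsumer.region (step z u) = R) :
    producerConsumer.RegionEdge (producerConsumer.region z) R := by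
  refine ⟨z, rfl, ?_⟩
  rw [transition_eq hz]
  have hpos : 0 < noise (Ioo a b) := by
    rw [Measure.restrict_apply measurableSet_Ioo,
      inter_eq_left.2 (Ioo_subset_Ioo ha hb), Real.volume_Ioo]
    exact ENNReal.ofReal_pos.2 (sub_pos.2 hab)
  exact (hpos.trans_le (measure_mono fun u hu => h u hu)).trans_le
    (Measure.le_map_apply (measurable_step_right z).aemeasurable _)

lemma eq_sinkRegion_of_regionEdge {R : producerConsumer.Region}
    (h : producerConsumer.RegionEdge sinkRegion R) : R = sinkRegion := by
  obtain ⟨z, hz, hpos⟩ := h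
  have hs : z.state = Sink := (regionRel_of_region_eq hz).state_eq
  have hgood : Good z := by rw [Good, hs]; trivial
  have hst : step z = fun _ => fire z {p} (1 - z.val p) := by
    funext u
    change stepAt z.state z u = _
    rw [hs, stepAt]
  rw [transition_eq hgood, hst, map_noise_const] at hpos
  obtain ⟨x, rfl, rfl⟩ := exists_mem_of_ae hpos
    (P := fun x => x = fire z {p} (1 - z.val p)) (by simp [ae_dirac_eq])
  have := region_step_sink hs 0
  rwa [hst] at this

lemma isBSCC_sinkRegion : producerConsumer.IsBSCC {sinkRegion} := by
  refine ⟨singleton_nonempty _, ?_⟩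
  rintro R rfl R'
  rw [mem_singleton_iff]
  constructor
  · intro h
    induction h with
    | refl => rfl
    | tail _ hedge ih =>
      subst ih
      exact eq_sinkRegion_of_regionEdge hedge
  · rintro rfl
    exact .refl

/-- `sinkRegion` is reachable from the region of `z` in the region graph. -/
def LeadsToSink (z : Cfg) : Prop :=
  Relation.ReflTransGen producerConsumer.RegionEdge (producerConsumer.region z) sinkRegion

lemma LeadsToSink.of_Ioo {z w : Cfg} (hw : LeadsToSink w) (hz : Good z) {a b : ℝ}
    (ha : 0 ≤ a) (hb : b ≤ 1) (hab : a < b)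
    (h : ∀ u ∈ Ioo a b, producerConsumer.region (step z u) = producerConsumer.region w) :
    LeadsToSink z :=
  .head (regionEdge_of_Ioo hz ha hb hab h) hw

lemma leadsToSink_sink {z : Cfg} (hs : z.state = Sink) : LeadsToSink z :=
  .single (regionEdge_of_Ioo (by rw [Good, hs]; trivial) le_rfl le_rfl one_pos
    fun u _ => region_step_sink hs u)

lemma region_eq_sink {z w : Cfg} (hz : z.state = Sink) (hw : w.state = Sink)
    (hz1 : 0 < z.val p ∧ z.val p < 1) (hw1 : 0 < w.val p ∧ w.val p < 1) :
    producerConsumer.region z = producerConsumer.region w := by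
  refine region_eq_of_lt_one (hz.trans hw.symm) ?_ ?_ <;> rw [hz]
  · intro e he
    cases e <;> simp [sched] at he
    exact ⟨hz1.2, hw1.2, by simp [hz1.1.ne', hw1.1.ne']⟩
  · intro e he f hf
    cases e <;> simp [sched] at he
    cases f <;> simp [sched] at hf
    simp

/-- In `Delivered`, goodness says that `c` and `t'` are 0 and `p` is strictly between 0 and 1. This
is a single region: the phase, which governs the failure probability, is invisible to the region
graph. -/
lemma region_eq_delivered {z w : Cfg} (hz : z.state = Delivered) (hw : w.state = Delivered)
    (hz1 : Good z) (hw1 : Good w) :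
    producerConsumer.region z = producerConsumer.region w := by
  rw [Good, hz] at hz1
  rw [Good, hw] at hw1
  obtain ⟨zc, zt, zp, zp1⟩ := hz1
  obtain ⟨wc, wt, wp, wp1⟩ := hw1
  refine region_eq_of_lt_one (hz.trans hw.symm) ?_ ?_ <;> rw [hz]
  · intro e he
    cases e <;> simp [sched] at he <;> simp [*, zp.ne', wp.ne']
  · intro e he f hf
    cases e <;> simp [sched] at he <;> cases f <;> simp [sched] at hf <;>
      simp [*, zp.ne', wp.ne']

lemma step_delivered {z : Cfg} (hz : Good z) (hs : z.state = Delivered) {u : ℝ}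
    (hu : u ∈ Ioo (0 : ℝ) (1 - z.val p)) :
    (step z u).state = Sink ∧ 0 < (step z u).val p ∧ (step z u).val p < 1 := by
  rw [Good, hs] at hz
  obtain ⟨hc, ht, hp, hp1⟩ := hz
  have h : u.toNNReal < 1 - z.val p := by
    rw [Real.toNNReal_lt_iff_lt_coe hu.1.le, NNReal.coe_sub hp1.le]
    exact hu.2
  have hst : step z u = fire z {t'} u.toNNReal := by
    change stepAt z.state z u = _
    simp [hs, stepAt, compete, ht, h]
  have hm : move Delivered {t'} = Sink := by simp [move]
  rw [hst, state_fire, hs, hm]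
  refine ⟨rfl, ?_⟩
  have hval : (fire z {t'} u.toNNReal).val p = z.val p + u.toNNReal := by
    simp [val_fire, hs, hm, sched]
  rw [hval]
  exact ⟨add_pos_of_pos_of_nonneg hp zero_le, add_lt_one h⟩

lemma leadsToSink_delivered {z : Cfg} (hz : Good z) (hs : z.state = Delivered) :
    LeadsToSink z := by
  have hp1 : (z.val p : ℝ) < 1 := by
    rw [Good, hs] at hz
    exact_mod_cast hz.2.2.2
  have hpos : (0 : ℝ) < 1 - z.val p := by linarith
  -- The midpoint only serves to name a representative of the target region.
  have hmid : (1 - z.val p : ℝ) / 2 ∈ Ioo (0 : ℝ) (1 - z.val p) :=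
    ⟨half_pos hpos, half_lt_self hpos⟩
  obtain ⟨h1, h2⟩ := step_delivered hz hs hmid
  refine (leadsToSink_sink h1).of_Ioo hz le_rfl (by simp) hpos fun u hu => ?_
  obtain ⟨h3, h4⟩ := step_delivered hz hs hu
  exact region_eq_sink h3 h1 h4 h2

lemma leadsToSink_waiting {z : Cfg} (hz : Good z) (hs : z.state = CWaiting) :
    LeadsToSink z := by
  have hstate : ∀ u ∈ Ioo (0 : ℝ) 1, (step z u).state = Delivered := by
    intro u hu
    have hz' := hz
    rw [Good, hs] at hz'
    change (stepAt z.state z u).state = _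
    rw [hs, stepAt, compete, hz'.1, if_pos (noise_factor_lt hz'.2 hu).2, state_fire, hs]
    simp [move]
  have hmid : (1 / 2 : ℝ) ∈ Ioo (0 : ℝ) 1 := by norm_num
  have hgood := fun {u : ℝ} (hu : u ∈ Ioo (0 : ℝ) 1) => good_step hz hu
  exact (leadsToSink_delivered (hgood hmid) (hstate _ hmid)).of_Ioo hz le_rfl le_rfl one_pos
    fun u hu => region_eq_delivered (hstate u hu) (hstate _ hmid) (hgood hu) (hgood hmid)

lemma leadsToSink_transporting {z : Cfg} (hz : Good z) (hs : z.state = Transporting) :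
    LeadsToSink z := by
  have hz' := hz
  rw [Good, hs] at hz'
  obtain ⟨hp, ht, hc, hc1⟩ := hz'
  have hc0 : (0 : ℝ) < z.val c := by exact_mod_cast hc
  have hc1' : (z.val c : ℝ) < 1 := by exact_mod_cast hc1
  -- With probability `z.val c > 0` the transport outlasts `c`, which leads back to `CWaiting`.
  have hst : ∀ u ∈ Ioo (1 - z.val c : ℝ) 1, step z u = fire z {c} (1 - z.val c) := by
    intro u hu
    have h : ¬ (1 - z.val t) * u.toNNReal < 1 - z.val c := by
      rw [ht, tsub_zero, one_mul, not_lt, ← NNReal.coe_le_coe, NNReal.coe_sub hc1.le,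
        Real.coe_toNNReal _ (by linarith [hu.1])]
      exact hu.1.le
    change stepAt z.state z u = _
    rw [hs, stepAt, compete, if_neg h]
  have hmid : (1 - z.val c / 2 : ℝ) ∈ Ioo (1 - z.val c : ℝ) 1 :=
    ⟨by linarith, by linarith⟩
  have hgood : Good (fire z {c} (1 - z.val c)) := by
    rw [← hst _ hmid]
    exact good_step hz ⟨by linarith, hmid.2⟩
  refine (leadsToSink_waiting hgood ?_).of_Ioo hz (by linarith) le_rfl (by linarith)
    fun u hu => congrArg _ (hst u hu)
  rw [state_fire, hs]
  simp [move]

lemma LeadsToSink.of_const {z w : Cfg} (hz : Good z) (hst : ∀ u, step z u = w)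
    (hw : Good w → LeadsToSink w) : LeadsToSink z := by
  have hmid : (1 / 2 : ℝ) ∈ Ioo (0 : ℝ) 1 := by norm_num
  have hgood : Good w := hst (1 / 2) ▸ good_step hz hmid
  exact (hw hgood).of_Ioo hz le_rfl le_rfl one_pos fun u _ => congrArg _ (hst u)

lemma leadsToSink_consuming {z : Cfg} (hz : Good z) (hs : z.state = Consuming)
    (h : ¬ z.val p < z.val c) : LeadsToSink z := by
  refine LeadsToSink.of_const hz (w := fire z {p} (1 - z.val p)) (fun u => ?_)
    fun hg => leadsToSink_transporting hg ?_
  · change stepAt z.state z u = _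
    rw [hs, stepAt, if_neg h]
  · rw [state_fire, hs]
    simp [move]

theorem leadsToSink {z : Cfg} (hz : Good z) : LeadsToSink z := by
  rcases hs : z.state
  · refine LeadsToSink.of_const hz (w := fire z {p} (1 - z.val p)) (fun u => ?_)
      fun hg => leadsToSink_waiting hg ?_
    · change stepAt z.state z u = _
      rw [hs, stepAt]
    · rw [state_fire, hs]
      simp [move]
  · exact leadsToSink_waiting hz hs
  · exact leadsToSink_delivered hz hs
  · exact leadsToSink_transporting hz hs
  · by_cases h : z.val p < z.val c
    · have hm : move Consuming {c} = Consuming := by simp [move]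
      refine LeadsToSink.of_const hz (w := fire z {c} (1 - z.val c)) (fun u => ?_)
        fun hg => leadsToSink_consuming hg ?_ ?_
      · change stepAt z.state z u = _
        rw [hs, stepAt, if_pos h]
      · rw [state_fire, hs, hm]
      · simp [val_fire, hs, hm, sched]
    · exact leadsToSink_consuming hz hs h
  · exact leadsToSink_sink hs

lemma regionReachable_sinkRegion : producerConsumer.RegionReachable sinkRegion :=
  ⟨Init, by change PMF.pure Init Init ≠ 0; simp, leadsToSink good_startCfg⟩

/-- A bottom strongly connected component that contains the region of a good configuration
consists of `sinkRegion`. -/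
theorem isBSCC_eq {C : Set producerConsumer.Region} (hC : producerConsumer.IsBSCC C) {z : Cfg}
    (hz : Good z) (hzC : producerConsumer.region z ∈ C) : C = {sinkRegion} := by
  -- A BSCC equals the set of regions reachable from any of its members; from `sinkRegion` only
  -- `sinkRegion` is reachable.
  have h1 : sinkRegion ∈ C := (hC.2 _ hzC _).1 (leadsToSink hz)
  ext R
  rw [← hC.2 _ h1 R, isBSCC_sinkRegion.2 _ rfl R]

lemma isBSCC_reachable_eq {C : Set producerConsumer.Region} (hC : producerConsumer.IsBSCC C)
    (h : ∃ R ∈ C, producerConsumer.RegionReachable R) : C = {sinkRegion} := by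
  obtain ⟨R, hRC, hR⟩ := h
  obtain ⟨w, hw, rfl⟩ := exists_good_of_regionReachable hR
  exact isBSCC_eq hC hw hRC

lemma state_eq_of_region_eq {z : Cfg} (h : producerConsumer.region z = sinkRegion) :
    z.state = Sink :=
  (regionRel_of_region_eq h).state_eq

end PC

/-! ### The main theorem -/

theorem mainTheorem2 :
    (∀ e, producerConsumer.IsFixed e ↔ e = PCEvent.p ∨ e = PCEvent.c) ∧
    producerConsumer.RegionAlgorithmReturnsOne PCState.Sink ∧
    (∃ C, producerConsumer.IsBSCC C ∧ ∃ R ∈ C, producerConsumer.RegionReachable R) ∧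
    (∀ C, producerConsumer.IsBSCC C → (∃ R ∈ C, producerConsumer.RegionReachable R) →
      ∀ R ∈ C, R.state = PCState.Sink) ∧
    (∃! Q : Measure (ℕ → producerConsumer.Config), producerConsumer.IsRunMeasure Q) ∧
    ∀ Q : Measure (ℕ → producerConsumer.Config), producerConsumer.IsRunMeasure Q →
      Q {σ | ∃ n, (σ n).state = PCState.Sink} < 1 ∧
      Q {σ | ∃ n, ∃ C, producerConsumer.IsBSCC C ∧ producerConsumer.region (σ n) ∈ C} < 1 ∧
      ∃ m : ℝ, 0 < m ∧
        HasProd (fun i : ℕ => (1 - (1 / 2 : ℝ) ^ (i + 1)) ^ (2 * (i + 1))) m ∧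
        ENNReal.ofReal m ≤ Q {σ | ∀ n, (σ n).state ≠ PCState.Sink} := by
  refine ⟨PC.isFixed_iff, ?_, ?_, ?_, PC.existsUnique_runMeasure, fun Q hQ => ⟨?_, ?_, ?_⟩⟩
  · intro C hC h
    rw [PC.isBSCC_reachable_eq hC h]
    exact ⟨_, rfl, rfl⟩
  · exact ⟨_, PC.isBSCC_sinkRegion, _, rfl, PC.regionReachable_sinkRegion⟩
  · intro C hC h R hR
    rw [PC.isBSCC_reachable_eq hC h] at hR
    rw [hR]
    rfl
  · exact PC.measure_lt_one_of_not_goodAvoiding hQ fun σ ⟨n, hn⟩ => ⟨n, fun h => h.2 hn⟩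
  · refine PC.measure_lt_one_of_not_goodAvoiding hQ fun σ ⟨n, C, hC, hn⟩ => ⟨n, fun h => h.2 ?_⟩
    rw [PC.isBSCC_eq hC h.1 hn] at hn
    exact PC.state_eq_of_region_eq hn
  · obtain ⟨m, hm0, hm, hprod⟩ := hasProd_one_sub_half_pow
    refine ⟨m, hm0, hprod, (ENNReal.ofReal_le_ofReal ?_).trans
      ((PC.exp_neg_one_le_measure hQ).trans (measure_mono fun σ hσ n => (hσ n).2))⟩
    -- It remains to compare `1/4` with `exp (-1)`, which holds because `e < 3`.
    refine hm.trans ?_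
    rw [Real.exp_neg, one_div]
    exact inv_anti₀ (Real.exp_pos 1) (by linarith [Real.exp_one_lt_three])
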